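/- Let $M$ be a smooth manifold and let $(P,Y)$ be a bundle gerbe over $M$: a surjective submersion $\pi\colon Y\to M$, a smooth principal $\mathbb C^\times$-bundle $P\to Y^{[2]}=Y\times_M Y$ and a smooth associative $\mathbb C^\times$-equivariant product $P_{(y_1,y_2)}\otimes P_{(y_2,y_3)}\to P_{(y_1,y_3)}$. Let $\nabla$ be a bundle gerbe connection (a connection on $P$ commuting with the product) and let $f\in\Omega^2(Y,\mathbb C)$ be a curving, i.e. the curvature of $\nabla$ satisfies $(F_\nabla)_{(y_1,y_2)}=f_{y_2}-f_{y_1}$. Let $\mathcal U=\{U_\alpha\}$ be an open cover of $M$ all of whose non-empty finite intersections are contractible, with smooth sections $s_\alpha\colon U_\alpha\to Y$ of $\pi$ and smooth sections $\sigma_{\alpha\beta}$ of $(s_\alpha,s_\beta)^{-1}(P)$ over $U_\alpha\cap U_\beta$. Put $\sigma_{\alpha\beta}\sigma_{\beta\gamma}=g_{\alpha\beta\gamma}\sigma_{\alpha\gamma}$, let $A_{\alpha\beta}=\sigma_{\alpha\beta}^*\nabla$ be the pull-back of the connection form and $f_\alpha=s_\alpha^*f$. Suppose that the Deligne class $D(P,\nabla,f)=[(g_{\alpha\beta\gamma},A_{\alpha\beta},f_\alpha)]\in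 H^2(M,\underline{\mathbb C}^\times\xrightarrow{d\log}\Omega^1\xrightarrow{d}\Omega^2)$ is zero, i.e. that there are smooth $h_{\alpha\beta}\colon U_\alpha\cap U_\beta\to\mathbb C^\times$ and smooth 1-forms $k_\alpha$ on $U_\alpha$ with $$g_{\alpha\beta\gamma}=h_{\beta\gamma}h_{\alpha\gamma}^{-1}h_{\alpha\beta},\qquad A_{\alpha\beta}=h_{\alpha\beta}^{-1}dh_{\alpha\beta}+k_\beta-k_\alpha,\qquad f_\alpha=dk_\alpha .$$ Then $P$ is a trivial bundle gerbe with trivial connection and curving: there are a smooth principal $\mathbb C^\times$-bundle $Q\to Y$ with a connection $\nabla_Q$ and an isomorphism of bundle gerbes $\delta(Q)\cong P$ over the identity of $Y$, where $\delta(Q)_{(y_1,y_2)}=Q_{y_1}^*\otimes Q_{y_2}$ with the product given by the pairing of $Q_{y_2}$ with $Q_{y_2}^*$, which carries the connection $\delta(\nabla_Q)$ induced by $\nabla_Q$ on $Q_{y_1}^*\otimes Q_{y_2}$ to $\nabla$, and $f$ is the curvature of $\nabla_Q$. -/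

import Mathlib

open scoped Manifold ContDiff Topology

universe uY

namespace Gerbe

universe uE uX

/-! ## Complex valued differential forms on smooth manifolds

All manifolds are smooth manifolds without boundary modelled on a Banach space `E`
(`ChartedSpace E X` with the model `𝓘(ℝ, E)`). -/

section Forms

variable {E : Type*} [NormedAddCommGroup E] [NormedSpace ℝ E]
  {X : Type*} [TopologicalSpace X] [ChartedSpace E X]
  {E' : Type*} [NormedAddCommGroup E'] [NormedSpace ℝ E']
  {X' : Type*} [TopologicalSpace X'] [ChartedSpace E' X']

/-- A (not necessarily smooth) complex valued differential `k`-form on the manifold `X`. -/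
abbrev DForm (E : Type uE) [NormedAddCommGroup E] [NormedSpace ℝ E] (k : ℕ)
    (X : Type uX) [TopologicalSpace X] [ChartedSpace E X] : Type (max uE uX) :=
  (x : X) → (TangentSpace 𝓘(ℝ, E) x) [⋀^Fin k]→L[ℝ] ℂ

/-- The pull-back `f^* θ`. -/
noncomputable def DForm.pullback {k : ℕ} (f : X → X') (θ : DForm E' k X') : DForm E k X :=
  fun x => (θ (f x)).compContinuousLinearMap (mfderiv 𝓘(ℝ, E) 𝓘(ℝ, E') f x)

/-- The expression of `θ` in the preferred chart at `x₀`: the pull-back of `θ` along the inverse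
of the chart. It is meaningful on the target of the chart, an open subset of `E`. -/
noncomputable def DForm.inChart {k : ℕ} (θ : DForm E k X) (x₀ : X) : E → E [⋀^Fin k]→L[ℝ] ℂ :=
  fun e => (θ ((extChartAt 𝓘(ℝ, E) x₀).symm e)).compContinuousLinearMap
    (mfderiv 𝓘(ℝ, E) 𝓘(ℝ, E) (extChartAt 𝓘(ℝ, E) x₀).symm e)

/-- `θ` is smooth at `x₀`. -/
def DForm.SmoothAt {k : ℕ} (θ : DForm E k X) (x₀ : X) : Prop :=
  ContDiffAt ℝ ∞ (θ.inChart x₀) (extChartAt 𝓘(ℝ, E) x₀ x₀)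

/-- `θ` is smooth at every point of `U`. -/
def DForm.SmoothOn {k : ℕ} (θ : DForm E k X) (U : Set X) : Prop :=
  ∀ x ∈ U, θ.SmoothAt x

/-- The exterior derivative `dθ`, computed at every point in the preferred chart there. -/
noncomputable def DForm.d {k : ℕ} (θ : DForm E k X) : DForm E (k + 1) X :=
  fun x => (extDeriv (θ.inChart x) (extChartAt 𝓘(ℝ, E) x x)).compContinuousLinearMap
    (mfderiv 𝓘(ℝ, E) 𝓘(ℝ, E) (extChartAt 𝓘(ℝ, E) x) x)

/-- The 1-form `d log h = h⁻¹ dh` of a function with values in `ℂˣ`. -/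
noncomputable def dlog (h : X → ℂˣ) : DForm E 1 X :=
  fun x =>
    let dh : TangentSpace 𝓘(ℝ, E) x →L[ℝ] ℂ := mfderiv 𝓘(ℝ, E) 𝓘(ℝ, ℂ) (fun y => (h y : ℂ)) x
    ContinuousAlternatingMap.ofSubsingleton ℝ (TangentSpace 𝓘(ℝ, E) x) ℂ (0 : Fin 1)
      ((((h x)⁻¹ : ℂˣ) : ℂ) • dh)

end Forms

/-! ## Principal `ℂˣ`-bundles and connections -/

section PrincipalBundle

variable {E : Type*} [NormedAddCommGroup E] [NormedSpace ℝ E]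
  {H : Type*} [TopologicalSpace H] (I : ModelWithCorners ℝ E H)
  {X : Type*} [TopologicalSpace X] [ChartedSpace H X]
  (EP : Type*) [NormedAddCommGroup EP] [NormedSpace ℝ EP]
  (P : Type*) [TopologicalSpace P] [ChartedSpace EP P] [MulAction ℂˣ P]

/-- A smooth principal `ℂˣ`-bundle `P → S`, where `S` is a submanifold of a manifold `X`. The two
cases in use are `S = univ` and the fibre product `S = Y ×_M Y ⊆ Y × Y` of a submersion `Y → M`.
A map defined on the submanifold `S` is smooth when it is `ContMDiffOn` there, that is (locally)
the restriction of a smooth map.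

The last condition says that over a neighbourhood `W ∩ S` of any point of `S` there is a smooth
section `σ`, and that `(w, z) ↦ z • σ w` is a diffeomorphism of `(W ∩ S) × ℂˣ` onto the part of `P`
over `W ∩ S`, the inverse being `p ↦ (proj p, c p)`. -/
structure PrincipalBundle (S : Set X) where
  proj : P → X
  proj_mem : ∀ p, proj p ∈ S
  proj_smooth : ContMDiff 𝓘(ℝ, EP) I ∞ proj
  smul_smooth : ContMDiff (𝓘(ℝ, ℂ).prod 𝓘(ℝ, EP)) 𝓘(ℝ, EP) ∞ (fun x : ℂˣ × P => x.1 • x.2)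
  proj_smul : ∀ (z : ℂˣ) (p : P), proj (z • p) = proj p
  simply_transitive : ∀ p q, proj p = proj q → ∃! z : ℂˣ, p = z • q
  locally_trivial : ∀ x ∈ S, ∃ W : Set X, IsOpen W ∧ x ∈ W ∧ ∃ (σ : X → P) (c : P → ℂˣ),
    ContMDiffOn I 𝓘(ℝ, EP) ∞ σ (W ∩ S) ∧ (∀ w ∈ W ∩ S, proj (σ w) = w) ∧
    ContMDiffOn 𝓘(ℝ, EP) 𝓘(ℝ, ℂ) ∞ c (proj ⁻¹' W) ∧
    ∀ p, proj p ∈ W → p = c p • σ (proj p)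

variable {I EP P}

open Classical in
/-- For `p` and `q` in the same fibre, the unique `z ∈ ℂˣ` with `p = z • q`. -/
noncomputable def PrincipalBundle.ratio {S : Set X} (B : PrincipalBundle I EP P S) (p q : P) : ℂˣ :=
  if h : B.proj p = B.proj q then (B.simply_transitive p q h).choose else 1

theorem PrincipalBundle.ratio_smul {S : Set X} (B : PrincipalBundle I EP P S) {p q : P}
    (h : B.proj p = B.proj q) : p = B.ratio p q • q := by
  unfold PrincipalBundle.ratio
  rw [dif_pos h]
  exact (B.simply_transitive p q h).choose_spec.1

/-- A connection on a principal `ℂˣ`-bundle, as a connection 1-form on the total space `P`: a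
smooth, `ℂˣ`-invariant 1-form with values in the Lie algebra `ℂ` of `ℂˣ` which takes the value `ξ`
on the vertical vector field generated by `ξ ∈ ℂ`.
Its curvature is the 2-form on the base whose pull-back to `P` is `dA`. -/
structure IsConnection (A : DForm EP 1 P) : Prop where
  smooth : ∀ p, A.SmoothAt p
  invariant : ∀ z : ℂˣ, A.pullback (fun p : P => z • p) = A
  vertical : ∀ (p : P) (ξ : ℂ),
    A p ![mfderiv 𝓘(ℝ, ℂ) 𝓘(ℝ, EP)
      (fun η : ℂ => Units.mk0 (Complex.exp η) (Complex.exp_ne_zero η) • p) 0 ξ] = ξ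

end PrincipalBundle

/-! ## Bundle gerbes, connections and curvings -/

section BundleGerbe

variable {EM : Type*} [NormedAddCommGroup EM] [NormedSpace ℝ EM]
  {M : Type*} [TopologicalSpace M] [ChartedSpace EM M]
  {EY : Type*} [NormedAddCommGroup EY] [NormedSpace ℝ EY]
  {Y : Type*} [TopologicalSpace Y] [ChartedSpace EY Y]
  (EP : Type*) [NormedAddCommGroup EP] [NormedSpace ℝ EP]
  (P : Type*) [TopologicalSpace P] [ChartedSpace EP P] [MulAction ℂˣ P]

/-- The fibre product `Y^[2] = Y ×_M Y`. -/
def fibreSquare (π : Y → M) : Set (Y × Y) := {y | π y.1 = π y.2}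

variable (EM EY) in
/-- A bundle gerbe `(P, Y)` over `M`: a surjective submersion `π : Y → M`, a principal `ℂˣ`-bundle
`P → Y^[2]` and an associative smooth product `P_(y₁,y₂) ⊗ P_(y₂,y₃) → P_(y₁,y₃)` which is
`ℂˣ`-equivariant. The function `mul` has a meaning only on pairs `(p, q)` with `p` over `(y₁, y₂)`
and `q` over `(y₂, y₃)`. -/
structure BundleGerbe (π : Y → M) where
  surjective : Function.Surjective π
  submersion : ∀ y, Manifold.IsSubmersionAt 𝓘(ℝ, EY) 𝓘(ℝ, EM) ∞ π y
  bundle : PrincipalBundle (𝓘(ℝ, EY).prod 𝓘(ℝ, EY)) EP P (fibreSquare π)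
  mul : P → P → P
  proj_mul : ∀ p q, (bundle.proj p).2 = (bundle.proj q).1 →
    bundle.proj (mul p q) = ((bundle.proj p).1, (bundle.proj q).2)
  smul_mul_smul : ∀ (z w : ℂˣ) (p q : P), (bundle.proj p).2 = (bundle.proj q).1 →
    mul (z • p) (w • q) = (z * w) • mul p q
  mul_assoc : ∀ p q r, (bundle.proj p).2 = (bundle.proj q).1 →
    (bundle.proj q).2 = (bundle.proj r).1 → mul (mul p q) r = mul p (mul q r)
  mul_smooth : ContMDiffOn (𝓘(ℝ, EP).prod 𝓘(ℝ, EP)) 𝓘(ℝ, EP) ∞ (fun x : P × P => mul x.1 x.2)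
    {x | (bundle.proj x.1).2 = (bundle.proj x.2).1}

namespace BundleGerbe

variable {EP P} {π : Y → M} (G : BundleGerbe EM EY EP P π)

/-- `src p = y₁` for `p ∈ P_(y₁,y₂)`. -/
def src (p : P) : Y := (G.bundle.proj p).1

/-- `tgt p = y₂` for `p ∈ P_(y₁,y₂)`. -/
def tgt (p : P) : Y := (G.bundle.proj p).2

/-- The submanifold of `P × P` on which the product is defined. -/
def composable : Set (P × P) := {x | G.tgt x.1 = G.src x.2}

/-- A bundle gerbe connection: a connection on `P` which commutes with the product, that is,
`mul^* A = pr₁^* A + pr₂^* A` on the submanifold `composable` of `P × P`.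
The tangent space of this submanifold at `(p, q)` consists of the pairs `(v, w)` with
`d tgt (v) = d src (w)`, and any two derivatives `L` of the product within the submanifold agree on
it. -/
structure IsGerbeConnection (A : DForm EP 1 P) : Prop where
  isConnection : IsConnection A
  mul_compatible : ∀ p q : P, (p, q) ∈ G.composable →
    ∀ L : TangentSpace (𝓘(ℝ, EP).prod 𝓘(ℝ, EP)) (p, q) →L[ℝ] TangentSpace 𝓘(ℝ, EP) (G.mul p q),
    HasMFDerivWithinAt (𝓘(ℝ, EP).prod 𝓘(ℝ, EP)) 𝓘(ℝ, EP) (fun x : P × P => G.mul x.1 x.2)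
      G.composable (p, q) L →
    ∀ (v : TangentSpace 𝓘(ℝ, EP) p) (w : TangentSpace 𝓘(ℝ, EP) q),
      (mfderiv 𝓘(ℝ, EP) 𝓘(ℝ, EY) G.tgt p v : EY) = mfderiv 𝓘(ℝ, EP) 𝓘(ℝ, EY) G.src q w →
      A (G.mul p q) ![L (v, w)] = A p ![v] + A q ![w]

/-- A curving for the bundle gerbe connection `A`: a smooth 2-form `f` on `Y` with
`F_(y₁,y₂) = f_(y₂) - f_(y₁)` for the curvature `F` of `A`. This is an equation of 2-forms on
`Y^[2]`; it is stated after pull-back along the surjective submersion `P → Y^[2]`, where `F`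
becomes `dA`. -/
structure IsCurving (A : DForm EP 1 P) (f : DForm EY 2 Y) : Prop where
  smooth : ∀ y, f.SmoothAt y
  descent : A.d = f.pullback G.tgt - f.pullback G.src

end BundleGerbe

end BundleGerbe

/-! ## The bundle gerbe `δ(Q)` of a `ℂˣ`-bundle `Q → Y` -/

section Delta

variable {M : Type*}
  {EY : Type*} [NormedAddCommGroup EY] [NormedSpace ℝ EY]
  {Y : Type*} [TopologicalSpace Y] [ChartedSpace EY Y]
  {EQ : Type*} [NormedAddCommGroup EQ] [NormedSpace ℝ EQ]
  {Q : Type*} [TopologicalSpace Q] [ChartedSpace EQ Q] [MulAction ℂˣ Q]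
  (B : PrincipalBundle 𝓘(ℝ, EY) EQ Q (Set.univ : Set Y)) (π : Y → M)

/-- The submanifold `{(q₁, q₂) | π(y₁) = π(y₂)}` of `Q × Q`, where `qᵢ` lies over `yᵢ`. -/
def deltaPairs : Set (Q × Q) := {x | π (B.proj x.1) = π (B.proj x.2)}

/-- The contracted product `Q_(y₁)^* ⊗ Q_(y₂)` is the quotient of `Q_(y₁)^* × Q_(y₂)` by the pairs
`(z, z⁻¹)`. As `ℂˣ` acts through the inverse on `Q_(y₁)^*`, it is the quotient of
`Q_(y₁) × Q_(y₂)` by the diagonal action. -/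
def deltaSetoid : Setoid (deltaPairs B π) where
  r x y := ∃ z : ℂˣ, y.1 = (z • x.1.1, z • x.1.2)
  iseqv :=
    { refl := fun x => ⟨1, by simp⟩
      symm := by
        rintro x y ⟨z, hz⟩
        refine ⟨z⁻¹, ?_⟩
        rw [hz]
        simp
      trans := by
        rintro x y w ⟨z, hz⟩ ⟨z', hz'⟩
        refine ⟨z' * z, ?_⟩
        rw [hz', hz]
        simp [mul_smul] }

/-- The total space of `δ(Q) = {Q_(y₁)^* ⊗ Q_(y₂)}` over `Y^[2]`. -/
def Delta : Type _ := Quotient (deltaSetoid B π)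

namespace Delta

/-- The class `q₁^* ⊗ q₂` of `(q₁, q₂)`. -/
def mk (q₁ q₂ : Q) (h : (q₁, q₂) ∈ deltaPairs B π) : Delta B π :=
  Quotient.mk (deltaSetoid B π) ⟨(q₁, q₂), h⟩

variable {B π}

theorem mk_eq_mk {q₁ q₂ r₁ r₂ : Q} {h : (q₁, q₂) ∈ deltaPairs B π}
    {h' : (r₁, r₂) ∈ deltaPairs B π} :
    mk B π q₁ q₂ h = mk B π r₁ r₂ h' ↔ ∃ z : ℂˣ, r₁ = z • q₁ ∧ r₂ = z • q₂ := by
  have key : mk B π q₁ q₂ h = mk B π r₁ r₂ h' ↔ ∃ z : ℂˣ, (r₁, r₂) = (z • q₁, z • q₂) :=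
    Quotient.eq (r := deltaSetoid B π)
  rw [key]
  simp

/-- The projection `δ(Q) → Y^[2]`. -/
def proj : Delta B π → Y × Y :=
  Quotient.lift (fun x => (B.proj x.1.1, B.proj x.1.2)) (by
    rintro x y ⟨z, hz⟩
    simp [hz, B.proj_smul])

/-- The action of `ℂˣ` on `δ(Q)`: `z • (q₁^* ⊗ q₂) = q₁^* ⊗ (z • q₂)`. -/
instance : SMul ℂˣ (Delta B π) where
  smul z := Quotient.map (fun x => ⟨(x.1.1, z • x.1.2), by
      have := x.2
      simpa [deltaPairs, B.proj_smul] using this⟩) (by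
    rintro x y ⟨w, hw⟩
    refine ⟨w, ?_⟩
    simp [hw, smul_smul, mul_comm])

open Classical in
/-- The product of `δ(Q)`, given by the natural pairing
`(q₁^* ⊗ q₂) ⊗ (q₂^* ⊗ q₃) ↦ q₁^* ⊗ q₃`; see `mul_mk`. It has a meaning only on pairs lying over
`(y₁, y₂)` and `(y₂, y₃)`. -/
noncomputable def mul (a b : Delta B π) : Delta B π :=
  if h : ∃ c : Delta B π, ∃ q₁ q₂ q₃ : Q, ∃ (h₁ : (q₁, q₂) ∈ deltaPairs B π)
      (h₂ : (q₂, q₃) ∈ deltaPairs B π) (h₃ : (q₁, q₃) ∈ deltaPairs B π),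
      a = mk B π q₁ q₂ h₁ ∧ b = mk B π q₂ q₃ h₂ ∧ c = mk B π q₁ q₃ h₃
  then h.choose else a

theorem mul_mk {q₁ q₂ q₃ : Q} (h₁ : (q₁, q₂) ∈ deltaPairs B π) (h₂ : (q₂, q₃) ∈ deltaPairs B π)
    (h₃ : (q₁, q₃) ∈ deltaPairs B π) :
    mul (mk B π q₁ q₂ h₁) (mk B π q₂ q₃ h₂) = mk B π q₁ q₃ h₃ := by
  unfold mul
  split_ifs with h
  · obtain ⟨r₁, r₂, r₃, k₁, k₂, k₃, e₁, e₂, e₃⟩ := h.choose_spec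
    rw [e₃]
    obtain ⟨z, hz₁, hz₂⟩ := mk_eq_mk.1 e₁
    obtain ⟨w, hw₁, hw₂⟩ := mk_eq_mk.1 e₂
    have hzw : z = w :=
      (B.simply_transitive r₂ q₂ (by rw [hz₂, B.proj_smul])).unique hz₂ hw₁
    subst hzw
    exact (mk_eq_mk.2 ⟨z, hz₁, hw₂⟩).symm
  · exact absurd ⟨_, q₁, q₂, q₃, h₁, h₂, h₃, rfl, rfl, rfl⟩ h

end Delta

variable {EM : Type*} [NormedAddCommGroup EM] [NormedSpace ℝ EM]
  [TopologicalSpace M] [ChartedSpace EM M]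
  {EP : Type*} [NormedAddCommGroup EP] [NormedSpace ℝ EP]
  {P : Type*} [TopologicalSpace P] [ChartedSpace EP P] [MulAction ℂˣ P]
  {π : Y → M}

/-- An isomorphism `δ(Q) ≃ P` of bundle gerbes over the identity of `Y`: a `ℂˣ`-equivariant smooth
bijection over `Y^[2]` commuting with the products. `Delta B π` carries the smooth structure of the
quotient of the manifold `deltaPairs B π`, so smoothness of a map on `Delta B π` means smoothness
of its composition with the quotient map; this composition is recorded as `lift`. (The inverse of an
equivariant smooth map of principal bundles over the identity is automatically smooth.) -/
structure DeltaIso (G : BundleGerbe EM EY EP P π) where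
  toFun : Delta B π → P
  bijective : Function.Bijective toFun
  proj_toFun : ∀ a, G.bundle.proj (toFun a) = a.proj
  toFun_smul : ∀ (z : ℂˣ) (a : Delta B π), toFun (z • a) = z • toFun a
  toFun_mul : ∀ a b : Delta B π, a.proj.2 = b.proj.1 →
    toFun (a.mul b) = G.mul (toFun a) (toFun b)
  lift : Q → Q → P
  lift_eq : ∀ (q₁ q₂ : Q) (h : (q₁, q₂) ∈ deltaPairs B π),
    lift q₁ q₂ = toFun (Delta.mk B π q₁ q₂ h)
  smooth : ContMDiffOn (𝓘(ℝ, EQ).prod 𝓘(ℝ, EQ)) 𝓘(ℝ, EP) ∞ (fun x : Q × Q => lift x.1 x.2)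
    (deltaPairs B π)

variable {B}

/-- The isomorphism `φ : δ(Q) ≃ P` carries the connection `δ(∇_Q)` to the connection `A` of `P`.
Here `δ(∇_Q)` is the connection on `δ(Q)` induced from the connection `AQ` on `Q`, with
connection form `AQ(q₂) - AQ(q₁)` at `q₁^* ⊗ q₂`; the equality of the 1-forms `φ^* A` and `δ(∇_Q)`
is stated after pull-back along the surjective submersion `deltaPairs B π → δ(Q)`. The tangent space
of the submanifold `deltaPairs B π` of `Q × Q` at `(q₁, q₂)` consists of the pairs `(v₁, v₂)` with
the same image in the tangent space of `M`. -/
def DeltaIso.PreservesConnection {G : BundleGerbe EM EY EP P π} (φ : DeltaIso B G)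
    (AQ : DForm EQ 1 Q) (A : DForm EP 1 P) : Prop :=
  ∀ q₁ q₂ : Q, (q₁, q₂) ∈ deltaPairs B π →
    ∀ L : TangentSpace (𝓘(ℝ, EQ).prod 𝓘(ℝ, EQ)) (q₁, q₂) →L[ℝ]
      TangentSpace 𝓘(ℝ, EP) (φ.lift q₁ q₂),
    HasMFDerivWithinAt (𝓘(ℝ, EQ).prod 𝓘(ℝ, EQ)) 𝓘(ℝ, EP) (fun x : Q × Q => φ.lift x.1 x.2)
      (deltaPairs B π) (q₁, q₂) L →
    ∀ (v₁ : TangentSpace 𝓘(ℝ, EQ) q₁) (v₂ : TangentSpace 𝓘(ℝ, EQ) q₂),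
      (mfderiv 𝓘(ℝ, EQ) 𝓘(ℝ, EM) (fun q => π (B.proj q)) q₁ v₁ : EM) =
        mfderiv 𝓘(ℝ, EQ) 𝓘(ℝ, EM) (fun q => π (B.proj q)) q₂ v₂ →
      A (φ.lift q₁ q₂) ![L (v₁, v₂)] = AQ q₂ ![v₂] - AQ q₁ ![v₁]

/-- `f` is the curvature 2-form of the connection `AQ`: the 2-form on `Y` whose pull-back to `Q` is
`d AQ`. -/
def IsCurvature (B : PrincipalBundle 𝓘(ℝ, EY) EQ Q (Set.univ : Set Y)) (AQ : DForm EQ 1 Q)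
    (f : DForm EY 2 Y) : Prop :=
  f.pullback B.proj = AQ.d

end Delta

/-! ## The Deligne class -/

section Deligne

variable {EM : Type*} [NormedAddCommGroup EM] [NormedSpace ℝ EM]
  {M : Type*} [TopologicalSpace M] [ChartedSpace EM M] {ι : Type*}

/-- An open cover of `M` all of whose non-empty finite intersections are contractible. -/
structure LerayCover (ι : Type*) (M : Type*) [TopologicalSpace M] where
  U : ι → Set M
  isOpen : ∀ α, IsOpen (U α)
  covers : ⋃ α, U α = Set.univ
  contractible : ∀ t : Finset ι, t.Nonempty → (⋂ α ∈ t, U α).Nonempty →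
    ContractibleSpace ↥(⋂ α ∈ t, U α)

variable (EM ι M) in
/-- The data `(h, k)` of an element of degree 1 of the total complex of the Čech-de Rham double
complex `C^p(𝒰, ℂˣ) → C^p(𝒰, Ω¹) → C^p(𝒰, Ω²)`, with `h ∈ C¹(𝒰, ℂˣ)` and `k ∈ C⁰(𝒰, Ω¹)`. A cochain
is represented by functions or forms on `M`, of which only the restrictions to the respective
intersections matter. -/
structure DeligneOne where
  h : ι → ι → M → ℂˣ
  k : ι → DForm EM 1 M

variable (EM ι M) in
/-- The data `(g, A, f)` of an element of degree 2 of the total complex, with `g ∈ C²(𝒰, ℂˣ)`,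
`A ∈ C¹(𝒰, Ω¹)` and `f ∈ C⁰(𝒰, Ω²)`. -/
structure DeligneTwo where
  g : ι → ι → ι → M → ℂˣ
  A : ι → ι → DForm EM 1 M
  f : ι → DForm EM 2 M

/-- `h` and `k` are smooth on the sets of the cover on which they are considered. -/
structure DeligneOne.IsSmooth (b : DeligneOne EM M ι) (𝒰 : LerayCover ι M) : Prop where
  smooth_h : ∀ α β, ContMDiffOn 𝓘(ℝ, EM) 𝓘(ℝ, ℂ) ∞ (b.h α β) (𝒰.U α ∩ 𝒰.U β)
  smooth_k : ∀ α, (b.k α).SmoothOn (𝒰.U α)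

/-- The differential of the total complex from degree 1 to degree 2,
`(h, k) ↦ (δh, d log h + δk, dk)`. -/
noncomputable def DeligneOne.D (b : DeligneOne EM M ι) : DeligneTwo EM M ι where
  g α β γ x := b.h β γ x * (b.h α γ x)⁻¹ * b.h α β x
  A α β := dlog (b.h α β) + (b.k β - b.k α)
  f α := (b.k α).d

/-- Equality of 2-cochains: equality of the components on the sets of the cover on which they are
considered. -/
structure DeligneTwo.EqOn (c c' : DeligneTwo EM M ι) (𝒰 : LerayCover ι M) : Prop where
  g_eq : ∀ α β γ, ∀ x ∈ 𝒰.U α ∩ 𝒰.U β ∩ 𝒰.U γ, c.g α β γ x = c'.g α β γ x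
  A_eq : ∀ α β, ∀ x ∈ 𝒰.U α ∩ 𝒰.U β, c.A α β x = c'.A α β x
  f_eq : ∀ α, ∀ x ∈ 𝒰.U α, c.f α x = c'.f α x

/-- The class of the 2-cocycle `c` in the cohomology of the total complex, that is, in the Deligne
cohomology `H²(M, ℂˣ → Ω¹ → Ω²)` computed with the Leray cover `𝒰`, is zero. -/
def DeligneTwo.ClassIsZero (c : DeligneTwo EM M ι) (𝒰 : LerayCover ι M) : Prop :=
  ∃ b : DeligneOne EM M ι, b.IsSmooth 𝒰 ∧ c.EqOn b.D 𝒰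

variable
  {EY : Type*} [NormedAddCommGroup EY] [NormedSpace ℝ EY]
  {Y : Type*} [TopologicalSpace Y] [ChartedSpace EY Y]
  {EP : Type*} [NormedAddCommGroup EP] [NormedSpace ℝ EP]
  {P : Type*} [TopologicalSpace P] [ChartedSpace EP P] [MulAction ℂˣ P]
  {π : Y → M}

/-- The choices made in the construction of the Deligne class: smooth sections `s α` of `Y → M` over
`U α`, and smooth sections `σ α β` of the pull-back of `P` by `(s α, s β)` over `U α ∩ U β`. -/
structure BundleGerbe.LocalSections (G : BundleGerbe EM EY EP P π) (𝒰 : LerayCover ι M) where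
  s : ι → M → Y
  s_smooth : ∀ α, ContMDiffOn 𝓘(ℝ, EM) 𝓘(ℝ, EY) ∞ (s α) (𝒰.U α)
  s_section : ∀ α, ∀ x ∈ 𝒰.U α, π (s α x) = x
  σ : ι → ι → M → P
  σ_smooth : ∀ α β, ContMDiffOn 𝓘(ℝ, EM) 𝓘(ℝ, EP) ∞ (σ α β) (𝒰.U α ∩ 𝒰.U β)
  σ_section : ∀ α β, ∀ x ∈ 𝒰.U α ∩ 𝒰.U β, G.bundle.proj (σ α β x) = (s α x, s β x)

/-- The Deligne cocycle `(g, A, f)` of a bundle gerbe with connection and curving: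
`σ_αβ σ_βγ = g_αβγ σ_αγ`, `A_αβ = σ_αβ^* A` and `f_α = s_α^* f`. -/
noncomputable def BundleGerbe.deligneCocycle (G : BundleGerbe EM EY EP P π) {𝒰 : LerayCover ι M}
    (c : G.LocalSections 𝒰) (A : DForm EP 1 P) (f : DForm EY 2 Y) : DeligneTwo EM M ι where
  g α β γ x := G.bundle.ratio (G.mul (c.σ α β x) (c.σ β γ x)) (c.σ α γ x)
  A α β := A.pullback (c.σ α β)
  f α := f.pullback (c.s α)

end Deligne

end Gerbe

/-! The trivialising cochain corrects the chosen sections: with `ρ α β = (h α β)⁻¹ • σ α β` the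
equation for `g` becomes `ρ_αβ ρ_βγ = ρ_αγ` and the equation for `A_αβ` becomes `ρ_αβ^* A = k_β -
k_α`. The resulting data form a `BundleGerbe.Splitting`, and the rest of the proof uses only these.

Over `π⁻¹ U_α` the bundle `Q` should have the fibre `P_(s_α(π y), y)`. Left multiplication by `ρ_αβ`
identifies the fibres for `β` and `α`, and `ρ_αβ ρ_βγ = ρ_αγ` makes these identifications
consistent. To get a manifold, `Q` is glued from `ℂˣ`-valued transition functions between local
sections `τ i` of these bundles (`UnitsCocycle`). The identification of `Q` with the fibres of `P`
then appears as equivariant maps `p α` into `P`, with `p_α = ρ_αβ p_β` (`p_change`).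

Everything else follows from this relation. The quotient `p_α(q₁)⁻¹ p_α(q₂)` does not depend on `α`,
because the factor `ρ_αβ` cancels, and it defines `δ(Q) → P` (`div_eq`, `deltaIso`). The form `p_α^*
A + π^* k_α` does not depend on `α` either, because `p_α^* A - p_β^* A = π^*(k_β - k_α)`
(`pullback_p`, `connection_eq`). Its differential is `(f - π^* s_α^* f) + π^* dk_α = f` by the
curving equation and `f_α = dk_α`. The product rule for `A` applied to `p_α(q₁) · (p_α(q₁)⁻¹
p_α(q₂)) = p_α(q₂)` shows that the isomorphism carries `δ(∇_Q)` to `∇`, since the terms in `k_α`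
cancel.

The supporting facts are the naturality of `d` (`DForm.d_pullback`), the rules for pulling `A` back
along an action and along a product (`IsConnection.pullback_smul`,
`IsGerbeConnection.pullback_mul`), the smoothness of left division in `P`
(`contMDiffWithinAt_ldiv`), and the existence of curves with prescribed velocities in a fibre
product (`exists_lift_curve`). -/

namespace Gerbe

/-! ### Pull-back, smoothness and exterior derivative of forms on manifolds -/

section FormLemmas

open Filter

variable {E : Type*} [NormedAddCommGroup E] [NormedSpace ℝ E]
  {X : Type*} [TopologicalSpace X] [ChartedSpace E X]
  {E' : Type*} [NormedAddCommGroup E'] [NormedSpace ℝ E']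
  {X' : Type*} [TopologicalSpace X'] [ChartedSpace E' X']
  {E'' : Type*} [NormedAddCommGroup E''] [NormedSpace ℝ E'']
  {X'' : Type*} [TopologicalSpace X''] [ChartedSpace E'' X'']

theorem mdifferentiableAt_extChartAt_symm [IsManifold 𝓘(ℝ, E) ∞ X] {x₀ : X} {e : E}
    (he : e ∈ (extChartAt 𝓘(ℝ, E) x₀).target) :
    MDifferentiableAt 𝓘(ℝ, E) 𝓘(ℝ, E) (extChartAt 𝓘(ℝ, E) x₀).symm e := by
  have h := mdifferentiableWithinAt_extChartAt_symm he
  rwa [ModelWithCorners.range_eq_univ, mdifferentiableWithinAt_univ] at h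

theorem DForm.pullback_comp_apply {k : ℕ} (θ : DForm E'' k X'') {g : X' → X''} {f : X → X'} {x : X}
    (hg : MDifferentiableAt 𝓘(ℝ, E') 𝓘(ℝ, E'') g (f x))
    (hf : MDifferentiableAt 𝓘(ℝ, E) 𝓘(ℝ, E') f x) :
    (θ.pullback g : DForm E' k X').pullback f x = (θ.pullback (g ∘ f) : DForm E k X) x := by
  unfold DForm.pullback
  rw [mfderiv_comp x hg hf]
  rfl

theorem DForm.pullback_add {k : ℕ} (θ η : DForm E' k X') (f : X → X') :
    ((θ + η).pullback f : DForm E k X) = θ.pullback f + η.pullback f := rfl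

theorem DForm.pullback_sub {k : ℕ} (θ η : DForm E' k X') (f : X → X') :
    ((θ - η).pullback f : DForm E k X) = θ.pullback f - η.pullback f := rfl

theorem DForm.pullback_congr_form {k : ℕ} {θ η : DForm E' k X'} {f : X → X'} {x : X}
    (h : θ (f x) = η (f x)) : (θ.pullback f : DForm E k X) x = (η.pullback f : DForm E k X) x := by
  unfold DForm.pullback
  rw [h]

theorem DForm.pullback_congr_apply {k : ℕ} (θ : DForm E' k X') {f g : X → X'} {x : X}
    (h : f =ᶠ[𝓝 x] g) : (θ.pullback f : DForm E k X) x = (θ.pullback g : DForm E k X) x := by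
  unfold DForm.pullback
  rw [h.mfderiv_eq, h.eq_of_nhds]

theorem DForm.inChart_congr {k : ℕ} {θ η : DForm E k X} {x₀ : X} (h : ∀ᶠ x in 𝓝 x₀, θ x = η x) :
    θ.inChart x₀ =ᶠ[𝓝 (extChartAt 𝓘(ℝ, E) x₀ x₀)] η.inChart x₀ := by
  have hc : Tendsto (extChartAt 𝓘(ℝ, E) x₀).symm (𝓝 (extChartAt 𝓘(ℝ, E) x₀ x₀)) (𝓝 x₀) := by
    have := continuousAt_extChartAt_symm (I := 𝓘(ℝ, E)) x₀
    rwa [ContinuousAt, extChartAt_to_inv] at this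
  filter_upwards [hc.eventually h] with e he
  simp only [DForm.inChart, he]

theorem DForm.SmoothAt.congr {k : ℕ} {θ η : DForm E k X} {x₀ : X} (hη : η.SmoothAt x₀)
    (h : ∀ᶠ x in 𝓝 x₀, θ x = η x) : θ.SmoothAt x₀ :=
  ContDiffAt.congr_of_eventuallyEq hη (DForm.inChart_congr h)

theorem DForm.d_congr {k : ℕ} {θ η : DForm E k X} {x₀ : X} (h : ∀ᶠ x in 𝓝 x₀, θ x = η x) :
    θ.d x₀ = η.d x₀ := by
  unfold DForm.d
  rw [(DForm.inChart_congr h).extDeriv_eq]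

theorem DForm.inChart_add {k : ℕ} (θ η : DForm E k X) (x₀ : X) :
    (θ + η).inChart x₀ = θ.inChart x₀ + η.inChart x₀ := rfl

theorem DForm.SmoothAt.add {k : ℕ} {θ η : DForm E k X} {x₀ : X} (hθ : θ.SmoothAt x₀)
    (hη : η.SmoothAt x₀) : (θ + η).SmoothAt x₀ :=
  ContDiffAt.add hθ hη

theorem DForm.d_add {k : ℕ} {θ η : DForm E k X} {x₀ : X} (hθ : θ.SmoothAt x₀)
    (hη : η.SmoothAt x₀) : (θ + η).d x₀ = θ.d x₀ + η.d x₀ := by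
  unfold DForm.d
  rw [DForm.inChart_add, extDeriv_add (ContDiffAt.differentiableAt hθ (by simp))
    (ContDiffAt.differentiableAt hη (by simp))]
  rfl

/-- Near the base point of a chart, the value of a form is recovered from its expression there. -/
theorem DForm.eq_inChart [IsManifold 𝓘(ℝ, E) ∞ X] {k : ℕ} (θ : DForm E k X) {x₀ x : X}
    (hx : x ∈ (extChartAt 𝓘(ℝ, E) x₀).source) :
    θ x = (θ.inChart x₀ (extChartAt 𝓘(ℝ, E) x₀ x)).compContinuousLinearMap
      (mfderiv 𝓘(ℝ, E) 𝓘(ℝ, E) (extChartAt 𝓘(ℝ, E) x₀) x) := by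
  have h1 : MDifferentiableAt 𝓘(ℝ, E) 𝓘(ℝ, E) (extChartAt 𝓘(ℝ, E) x₀) x :=
    mdifferentiableAt_extChartAt (by simpa using hx)
  have h2 := mdifferentiableAt_extChartAt_symm ((extChartAt 𝓘(ℝ, E) x₀).map_source hx)
  have h3 := DForm.pullback_comp_apply θ h2 h1
  have h4 : (extChartAt 𝓘(ℝ, E) x₀).symm ∘ (extChartAt 𝓘(ℝ, E) x₀) =ᶠ[𝓝 x] id := by
    filter_upwards [(isOpen_extChartAt_source x₀).mem_nhds hx] with y hy
    exact (extChartAt 𝓘(ℝ, E) x₀).left_inv hy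
  rw [DForm.pullback_congr_apply θ h4] at h3
  have h5 : (θ.pullback id : DForm E k X) x = θ x := by
    unfold DForm.pullback
    rw [mfderiv_id]
    rfl
  rw [← h5, ← h3]
  rfl

/-- The value of `θ` near `g x₀` is recovered from its chart expression by `DForm.eq_inChart`, and
the derivatives then combine by the chain rule. This reduces smoothness and `d` of a pull-back to
statements on vector spaces. -/
theorem DForm.inChart_pullback [IsManifold 𝓘(ℝ, E) ∞ X] [IsManifold 𝓘(ℝ, E') ∞ X'] {k : ℕ}
    (θ : DForm E' k X') {g : X → X'} {x₀ : X} (hg : ContMDiffAt 𝓘(ℝ, E) 𝓘(ℝ, E') ∞ g x₀) :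
    (θ.pullback g : DForm E k X).inChart x₀ =ᶠ[𝓝 (extChartAt 𝓘(ℝ, E) x₀ x₀)] fun e =>
      (θ.inChart (g x₀) (writtenInExtChartAt 𝓘(ℝ, E) 𝓘(ℝ, E') x₀ g e)).compContinuousLinearMap
        (fderiv ℝ (writtenInExtChartAt 𝓘(ℝ, E) 𝓘(ℝ, E') x₀ g) e) := by
  have hc : Tendsto (extChartAt 𝓘(ℝ, E) x₀).symm (𝓝 (extChartAt 𝓘(ℝ, E) x₀ x₀)) (𝓝 x₀) := by
    have := continuousAt_extChartAt_symm (I := 𝓘(ℝ, E)) x₀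
    rwa [ContinuousAt, extChartAt_to_inv] at this
  -- Passing from a point to a neighbourhood requires a finite order of smoothness; order 1 is
  -- enough here.
  have hd : ∀ᶠ x in 𝓝 x₀, MDifferentiableAt 𝓘(ℝ, E) 𝓘(ℝ, E') g x := by
    filter_upwards [contMDiffAt_iff_contMDiffAt_nhds (by simp) |>.1 (hg.of_le (m := 1) (by simp))] with x hx
    exact hx.mdifferentiableAt one_ne_zero
  have hs : ∀ᶠ x in 𝓝 x₀, g x ∈ (extChartAt 𝓘(ℝ, E') (g x₀)).source :=
    hg.continuousAt.eventually (extChartAt_source_mem_nhds (g x₀))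
  filter_upwards [hc.eventually hd, hc.eventually hs, extChartAt_target_mem_nhds x₀]
    with e he1 he2 he3
  have h1 := mdifferentiableAt_extChartAt_symm he3
  have h2 : MDifferentiableAt 𝓘(ℝ, E') 𝓘(ℝ, E') (extChartAt 𝓘(ℝ, E') (g x₀))
      (g ((extChartAt 𝓘(ℝ, E) x₀).symm e)) := mdifferentiableAt_extChartAt (by simpa using he2)
  have h3 : fderiv ℝ (writtenInExtChartAt 𝓘(ℝ, E) 𝓘(ℝ, E') x₀ g) e =
      (mfderiv 𝓘(ℝ, E') 𝓘(ℝ, E') (extChartAt 𝓘(ℝ, E') (g x₀))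
        (g ((extChartAt 𝓘(ℝ, E) x₀).symm e))).comp
      ((mfderiv 𝓘(ℝ, E) 𝓘(ℝ, E') g ((extChartAt 𝓘(ℝ, E) x₀).symm e)).comp
        (mfderiv 𝓘(ℝ, E) 𝓘(ℝ, E) (extChartAt 𝓘(ℝ, E) x₀).symm e)) := by
    rw [← mfderiv_eq_fderiv]
    unfold writtenInExtChartAt
    rw [mfderiv_comp e (g := extChartAt 𝓘(ℝ, E') (g x₀)) (f := g ∘ (extChartAt 𝓘(ℝ, E) x₀).symm)
      h2 (he1.comp e h1), mfderiv_comp e he1 h1]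
    rfl
  rw [h3]
  have h4 := θ.eq_inChart he2
  unfold DForm.inChart DForm.pullback at *
  rw [h4]
  rfl

theorem contDiffAt_writtenInExtChartAt {g : X → X'} {x₀ : X}
    (hg : ContMDiffAt 𝓘(ℝ, E) 𝓘(ℝ, E') ∞ g x₀) :
    ContDiffAt ℝ ∞ (writtenInExtChartAt 𝓘(ℝ, E) 𝓘(ℝ, E') x₀ g) (extChartAt 𝓘(ℝ, E) x₀ x₀) := by
  have h := (contMDiffAt_iff.1 hg).2
  rwa [ModelWithCorners.range_eq_univ, contDiffWithinAt_univ] at h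

/-- Alternating 1-forms are isometric to linear functionals, where pulling back is composition of
continuous linear maps, a bounded bilinear operation. -/
theorem contDiffAt_compContinuousLinearMap_one {η : E → E' [⋀^Fin 1]→L[ℝ] ℂ} {L : E → E →L[ℝ] E'}
    {e : E} (hη : ContDiffAt ℝ ∞ η e) (hL : ContDiffAt ℝ ∞ L e) :
    ContDiffAt ℝ ∞ (fun u => (η u).compContinuousLinearMap (L u)) e := by
  let Φ := ContinuousAlternatingMap.ofSubsingletonLIE (𝕜 := ℝ) (E := E) (F := ℂ) (ι := Fin 1) 0
  let Φ' := ContinuousAlternatingMap.ofSubsingletonLIE (𝕜 := ℝ) (E := E') (F := ℂ) (ι := Fin 1) 0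
  have h1 : ContDiffAt ℝ ∞ (fun u => Φ ((Φ'.symm (η u)).comp (L u))) e :=
    Φ.contDiff.contDiffAt.comp e ((Φ'.symm.contDiff.contDiffAt.comp e hη).clm_comp hL)
  refine h1.congr_of_eventuallyEq (Eventually.of_forall fun u => ?_)
  ext v
  have : v = fun _ => v 0 := by ext i; rw [Subsingleton.elim i 0]
  change η u (L u ∘ v) = η u _
  congr 1
  ext i
  rw [Subsingleton.elim i 0]
  rfl

variable [IsManifold 𝓘(ℝ, E) ∞ X] [IsManifold 𝓘(ℝ, E') ∞ X']

theorem DForm.SmoothAt.pullback {θ : DForm E' 1 X'} {g : X → X'} {x₀ : X} (hθ : θ.SmoothAt (g x₀))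
    (hg : ContMDiffAt 𝓘(ℝ, E) 𝓘(ℝ, E') ∞ g x₀) : (θ.pullback g : DForm E 1 X).SmoothAt x₀ := by
  have hG := contDiffAt_writtenInExtChartAt hg
  refine ContDiffAt.congr_of_eventuallyEq ?_ (θ.inChart_pullback hg)
  refine contDiffAt_compContinuousLinearMap_one (ContDiffAt.comp (g := θ.inChart (g x₀)) _ ?_ hG)
    (hG.fderiv_right (m := ∞) (by simp))
  have : writtenInExtChartAt 𝓘(ℝ, E) 𝓘(ℝ, E') x₀ g (extChartAt 𝓘(ℝ, E) x₀ x₀) =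
      extChartAt 𝓘(ℝ, E') (g x₀) (g x₀) := by simp [writtenInExtChartAt]
  rw [this]
  exact hθ

/-- Since `d` at a point is computed in the preferred chart there, the claim is `extDeriv_pullback`
for `g` written in the charts at `x₀` and `g x₀`, up to the exchange of derivatives in `h1`. -/
theorem DForm.d_pullback {k : ℕ} {θ : DForm E' k X'} {g : X → X'} {x₀ : X}
    (hθ : θ.SmoothAt (g x₀)) (hg : ContMDiffAt 𝓘(ℝ, E) 𝓘(ℝ, E') ∞ g x₀) :
    (θ.pullback g : DForm E k X).d x₀ = (θ.d.pullback g : DForm E (k + 1) X) x₀ := by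
  have hG := contDiffAt_writtenInExtChartAt hg
  have he : writtenInExtChartAt 𝓘(ℝ, E) 𝓘(ℝ, E') x₀ g (extChartAt 𝓘(ℝ, E) x₀ x₀) =
      extChartAt 𝓘(ℝ, E') (g x₀) (g x₀) := by simp [writtenInExtChartAt]
  have hθ' : DifferentiableAt ℝ (θ.inChart (g x₀))
      (writtenInExtChartAt 𝓘(ℝ, E) 𝓘(ℝ, E') x₀ g (extChartAt 𝓘(ℝ, E) x₀ x₀)) := by
    rw [he]
    exact ContDiffAt.differentiableAt hθ (by simp)
  -- Differentiates the identity (`g` in charts) ∘ chart = chart ∘ `g`, valid near `x₀`.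
  have h1 : (fderiv ℝ (writtenInExtChartAt 𝓘(ℝ, E) 𝓘(ℝ, E') x₀ g)
        (extChartAt 𝓘(ℝ, E) x₀ x₀)).comp
        (mfderiv 𝓘(ℝ, E) 𝓘(ℝ, E) (extChartAt 𝓘(ℝ, E) x₀) x₀) =
      (mfderiv 𝓘(ℝ, E') 𝓘(ℝ, E') (extChartAt 𝓘(ℝ, E') (g x₀)) (g x₀)).comp
        (mfderiv 𝓘(ℝ, E) 𝓘(ℝ, E') g x₀) := by
    have hg' := hg.mdifferentiableAt (by simp)
    have hx : MDifferentiableAt 𝓘(ℝ, E) 𝓘(ℝ, E) (extChartAt 𝓘(ℝ, E) x₀) x₀ :=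
      mdifferentiableAt_extChartAt (mem_chart_source E x₀)
    have hy : MDifferentiableAt 𝓘(ℝ, E') 𝓘(ℝ, E') (extChartAt 𝓘(ℝ, E') (g x₀)) (g x₀) :=
      mdifferentiableAt_extChartAt (mem_chart_source E' (g x₀))
    rw [← mfderiv_eq_fderiv, ← mfderiv_comp x₀ hy hg']
    have hm : MDifferentiableAt 𝓘(ℝ, E) 𝓘(ℝ, E')
        (writtenInExtChartAt 𝓘(ℝ, E) 𝓘(ℝ, E') x₀ g) (extChartAt 𝓘(ℝ, E) x₀ x₀) :=
      (hG.differentiableAt (by simp)).mdifferentiableAt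
    refine (mfderiv_comp x₀ hm hx).symm.trans (EventuallyEq.mfderiv_eq ?_)
    filter_upwards [extChartAt_source_mem_nhds (I := 𝓘(ℝ, E)) x₀] with y hy
    simp only [Function.comp, writtenInExtChartAt, (extChartAt 𝓘(ℝ, E) x₀).left_inv hy]
  unfold DForm.d
  rw [(θ.inChart_pullback hg).extDeriv_eq, extDeriv_pullback hθ' hG (r := ∞)
    (by simpa using ENat.LEInfty.out)]
  unfold DForm.pullback
  rw [he]
  ext v
  change extDeriv (θ.inChart (g x₀)) (extChartAt 𝓘(ℝ, E') (g x₀) (g x₀)) (fun i => ((fderiv ℝ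
    (writtenInExtChartAt 𝓘(ℝ, E) 𝓘(ℝ, E') x₀ g) (extChartAt 𝓘(ℝ, E) x₀ x₀)).comp
    (mfderiv 𝓘(ℝ, E) 𝓘(ℝ, E) (extChartAt 𝓘(ℝ, E) x₀) x₀)) (v i)) = _
  rw [h1]
  rfl

end FormLemmas


/-! ### Gluing a principal `ℂˣ`-bundle from transition functions -/

section CocycleBundle

open Set

/-- The unit with a given non-zero value; `1` at zero. -/
noncomputable def unitOf (w : ℂ) : ℂˣ := open Classical in if h : w = 0 then 1 else Units.mk0 w h

theorem coe_unitOf {w : ℂ} (h : w ≠ 0) : (unitOf w : ℂ) = w := by simp [unitOf, h]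

theorem unitOf_coe (z : ℂˣ) : unitOf (z : ℂ) = z := Units.ext (coe_unitOf z.ne_zero)

/-- The inclusion of `ℂˣ` in `ℂ` is an open embedding that serves as the chart of `ℂˣ`, and `unitOf`
is its inverse. -/
theorem contMDiffOn_unitOf : ContMDiffOn 𝓘(ℝ, ℂ) 𝓘(ℝ, ℂ) ∞ unitOf {w | w ≠ 0} := by
  refine ((contMDiffOn_isOpenEmbedding_symm (I := 𝓘(ℝ, ℂ)) (n := ∞)
    (Units.isOpenEmbedding_val (R := ℂ))).mono ?_).congr fun w hw => ?_
  · exact fun w hw => ⟨Units.mk0 w hw, rfl⟩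
  · have h := (Units.isOpenEmbedding_val (R := ℂ)).toOpenPartialHomeomorph_left_inv (x := unitOf w)
    rw [coe_unitOf hw] at h
    exact h.symm

theorem contMDiffOn_units {E H X : Type*} [NormedAddCommGroup E] [NormedSpace ℝ E]
    [TopologicalSpace H] {I : ModelWithCorners ℝ E H} [TopologicalSpace X] [ChartedSpace H X]
    {f : X → ℂˣ} {s : Set X} (hf : ContMDiffOn I 𝓘(ℝ, ℂ) ∞ (fun x => (f x : ℂ)) s) :
    ContMDiffOn I 𝓘(ℝ, ℂ) ∞ f s :=
  (contMDiffOn_unitOf.comp hf fun x _ => (f x).ne_zero).congr fun x _ => (unitOf_coe (f x)).symm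

/-- A cocycle of smooth transition functions with values in `ℂˣ`, for an open cover `V` of `Y`
indexed by the points of `Y` and such that `V i` is contained in the domain of the preferred chart
at `i`. -/
structure UnitsCocycle (EY : Type*) [NormedAddCommGroup EY] [NormedSpace ℝ EY]
    (Y : Type uY) [TopologicalSpace Y] [ChartedSpace EY Y] where
  V : Y → Set Y
  isOpen : ∀ i, IsOpen (V i)
  mem : ∀ i, i ∈ V i
  subset_chart : ∀ i, V i ⊆ (chartAt EY i).source
  t : Y → Y → Y → ℂˣ
  smooth : ∀ i j, ContMDiffOn 𝓘(ℝ, EY) 𝓘(ℝ, ℂ) ∞ (t i j) (V i ∩ V j)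
  comp : ∀ i j k, ∀ y, y ∈ V i → y ∈ V j → y ∈ V k → t i j y * t j k y = t i k y

namespace UnitsCocycle

variable {EY : Type*} [NormedAddCommGroup EY] [NormedSpace ℝ EY]
  {Y : Type uY} [TopologicalSpace Y] [ChartedSpace EY Y] (Z : UnitsCocycle EY Y)

theorem t_self {i y : Y} (h : y ∈ Z.V i) : Z.t i i y = 1 := by
  have := Z.comp i i i y h h h
  simpa using this

/-- The total space of the principal bundle glued from the cocycle `Z`. The fibre over `y` is
identified with `ℂˣ` by the trivialisation over `V y`. -/
@[ext]
structure Total (Z : UnitsCocycle EY Y) : Type uY where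
  base : Y
  fib : ℂˣ

variable {Z}

/-- The fibre coordinate of the trivialisation over `V i`. -/
noncomputable def coord (i : Y) (q : Z.Total) : ℂˣ := Z.t i q.base q.base * q.fib

variable (Z) in
/-- The point over `y` with given coordinate in the trivialisation over `V i`. -/
noncomputable def point (i y : Y) (z : ℂˣ) : Z.Total := ⟨y, Z.t y i y * z⟩

@[simp] theorem point_base (i y : Y) (z : ℂˣ) : (Z.point i y z).base = y := rfl

theorem coord_point {i y : Y} (h : y ∈ Z.V i) (z : ℂˣ) : coord i (Z.point i y z) = z := by
  simp only [coord, point]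
  rw [← mul_assoc, Z.comp i y i y h (Z.mem y) h, Z.t_self h, one_mul]

theorem point_coord {i : Y} {q : Z.Total} (h : q.base ∈ Z.V i) : Z.point i q.base (coord i q) = q := by
  ext1
  · rfl
  · simp only [coord, point]
    rw [← mul_assoc, Z.comp _ i _ _ (Z.mem _) h (Z.mem _), Z.t_self (Z.mem _), one_mul]

theorem coord_eq {i j : Y} {q : Z.Total} (hi : q.base ∈ Z.V i) (hj : q.base ∈ Z.V j) :
    coord i q = Z.t i j q.base * coord j q := by
  simp only [coord]
  rw [← mul_assoc, Z.comp i j _ _ hi hj (Z.mem _)]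

variable (Z) in
/-- The chart of the total space over `V i`. -/
noncomputable def chart (i : Y) : PartialEquiv Z.Total (EY × ℂ) where
  toFun q := (chartAt EY i q.base, (coord i q : ℂ))
  invFun p := Z.point i ((chartAt EY i).symm p.1) (unitOf p.2)
  source := {q | q.base ∈ Z.V i}
  target := {p | p.1 ∈ (chartAt EY i).target ∩ (chartAt EY i).symm ⁻¹' Z.V i ∧ p.2 ≠ 0}
  map_source' q hq := by
    have h := Z.subset_chart i hq
    refine ⟨⟨(chartAt EY i).map_source h, ?_⟩, Units.ne_zero _⟩
    rw [mem_preimage, (chartAt EY i).left_inv h]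
    exact hq
  map_target' p hp := hp.1.2
  left_inv' q hq := by
    simp only [(chartAt EY i).left_inv (Z.subset_chart i hq), unitOf_coe]
    exact point_coord hq
  right_inv' p hp := by
    ext1
    · exact (chartAt EY i).right_inv hp.1.1
    · simp only [coord_point hp.1.2, coe_unitOf hp.2]

theorem transition_source (i j : Y) : ((Z.chart i).symm.trans (Z.chart j)).source =
    ((chartAt EY i).target ∩ (chartAt EY i).symm ⁻¹' (Z.V i ∩ Z.V j)) ×ˢ {w : ℂ | w ≠ 0} := by
  ext p
  simp only [PartialEquiv.trans_source, chart, mem_inter_iff,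
    mem_preimage, mem_ofPred_eq, mem_prod, PartialEquiv.symm, point_base]
  tauto

theorem isOpen_transition_source (i j : Y) :
    IsOpen ((Z.chart i).symm.trans (Z.chart j)).source := by
  rw [transition_source]
  exact ((chartAt EY i).symm.isOpen_inter_preimage ((Z.isOpen i).inter (Z.isOpen j))).prod
    isOpen_ne

theorem transition_apply {i j : Y} {p : EY × ℂ}
    (hp : p ∈ ((Z.chart i).symm.trans (Z.chart j)).source) :
    (Z.chart i).symm.trans (Z.chart j) p = (chartAt EY j ((chartAt EY i).symm p.1),
      (Z.t j i ((chartAt EY i).symm p.1) : ℂ) * p.2) := by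
  rw [transition_source] at hp
  ext1
  · rfl
  · change ((coord j (Z.point i ((chartAt EY i).symm p.1) (unitOf p.2)) : ℂˣ) : ℂ) = _
    rw [coord_eq hp.1.2.2 hp.1.2.1, coord_point hp.1.2.1, Units.val_mul, coe_unitOf hp.2]
    rfl

noncomputable instance : MulAction ℂˣ Z.Total where
  smul z q := ⟨q.base, z * q.fib⟩
  one_smul q := by
    change (⟨q.base, 1 * q.fib⟩ : Z.Total) = q
    rw [one_mul]
  mul_smul z w q := by
    change (⟨q.base, z * w * q.fib⟩ : Z.Total) = ⟨q.base, z * (w * q.fib)⟩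
    rw [mul_assoc]

theorem smul_point (i y : Y) (z w : ℂˣ) : z • Z.point i y w = Z.point i y (z * w) := by
  change (⟨y, z * (Z.t y i y * w)⟩ : Z.Total) = ⟨y, Z.t y i y * (z * w)⟩
  rw [mul_left_comm]

variable [IsManifold 𝓘(ℝ, EY) ∞ Y]

/-- In coordinates the transition is `(u, w) ↦ (chart change of Y at u, t j i · w)`, so it is smooth
because the charts of `Y` and the cocycle are. -/
theorem contDiffOn_transition (i j : Y) :
    ContDiffOn ℝ ∞ ((Z.chart i).symm.trans (Z.chart j))
      ((Z.chart i).symm.trans (Z.chart j)).source := by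
  have h1 : ContDiffOn ℝ ∞ (fun u => chartAt EY j ((chartAt EY i).symm u))
      ((chartAt EY i).target ∩ (chartAt EY i).symm ⁻¹' (Z.V i ∩ Z.V j)) := by
    rw [← contMDiffOn_iff_contDiffOn]
    refine (contMDiffOn_chart (I := 𝓘(ℝ, EY)) (x := j)).comp
      ((contMDiffOn_chart_symm (I := 𝓘(ℝ, EY)) (x := i)).mono inter_subset_left) ?_
    exact fun u hu => Z.subset_chart j hu.2.2
  have h2 : ContDiffOn ℝ ∞ (fun u => (Z.t j i ((chartAt EY i).symm u) : ℂ))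
      ((chartAt EY i).target ∩ (chartAt EY i).symm ⁻¹' (Z.V i ∩ Z.V j)) := by
    rw [← contMDiffOn_iff_contDiffOn]
    refine (Units.contMDiff_val (𝕜 := ℝ)).comp_contMDiffOn ((Z.smooth j i).comp
      ((contMDiffOn_chart_symm (I := 𝓘(ℝ, EY)) (x := i)).mono inter_subset_left) ?_)
    exact fun u hu => ⟨hu.2.2, hu.2.1⟩
  refine ContDiffOn.congr ?_ fun p hp => transition_apply hp
  rw [transition_source]
  exact (h1.comp contDiffOn_fst fun p hp => hp.1).prodMk
    ((h2.comp contDiffOn_fst fun p hp => hp.1).mul contDiffOn_snd)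

variable (Z) in
/-- The charts of the total space. -/
noncomputable def core : ChartedSpaceCore (EY × ℂ) Z.Total where
  atlas := range Z.chart
  chartAt q := Z.chart q.base
  mem_chart_source q := Z.mem q.base
  chart_mem_atlas q := mem_range_self _
  open_source := by
    rintro _ _ ⟨i, rfl⟩ ⟨j, rfl⟩
    exact isOpen_transition_source i j
  continuousOn_toFun := by
    rintro _ _ ⟨i, rfl⟩ ⟨j, rfl⟩
    exact (contDiffOn_transition i j).continuousOn

noncomputable instance : TopologicalSpace Z.Total := Z.core.toTopologicalSpace

noncomputable instance : ChartedSpace (EY × ℂ) Z.Total := Z.core.toChartedSpace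

variable (Z) in
/-- The chart over `V i` as an open partial homeomorphism. -/
noncomputable def ochart (i : Y) : OpenPartialHomeomorph Z.Total (EY × ℂ) :=
  Z.core.openPartialHomeomorph (Z.chart i) (mem_range_self i)

theorem ochart_mem_atlas (i : Y) : Z.ochart i ∈ atlas (EY × ℂ) Z.Total :=
  mem_iUnion₂.2 ⟨Z.chart i, mem_range_self i, rfl⟩

theorem mem_atlas {e : OpenPartialHomeomorph Z.Total (EY × ℂ)} (he : e ∈ atlas (EY × ℂ) Z.Total) :
    ∃ i, e = Z.ochart i := by
  obtain ⟨_, ⟨i, rfl⟩, h⟩ := mem_iUnion₂.1 he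
  exact ⟨i, h⟩

instance : IsManifold 𝓘(ℝ, EY × ℂ) ∞ Z.Total := by
  apply isManifold_of_contDiffOn
  intro e e' he he'
  obtain ⟨i, rfl⟩ := mem_atlas he
  obtain ⟨j, rfl⟩ := mem_atlas he'
  simp only [modelWithCornersSelf_coe, modelWithCornersSelf_coe_symm, range_id, inter_univ,
    preimage_id_eq, id_eq, Function.id_comp, Function.comp_id]
  exact contDiffOn_transition i j

theorem ochart_mem_maximalAtlas (i : Y) :
    Z.ochart i ∈ IsManifold.maximalAtlas 𝓘(ℝ, EY × ℂ) ∞ Z.Total :=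
  IsManifold.subset_maximalAtlas (ochart_mem_atlas i)

theorem contMDiffOn_ochart (i : Y) :
    ContMDiffOn 𝓘(ℝ, EY × ℂ) 𝓘(ℝ, EY × ℂ) ∞ (Z.ochart i) {q | q.base ∈ Z.V i} :=
  contMDiffOn_of_mem_maximalAtlas (ochart_mem_maximalAtlas i)

theorem isOpen_base_preimage (i : Y) : IsOpen {q : Z.Total | q.base ∈ Z.V i} :=
  (Z.ochart i).open_source

theorem contMDiff_base : ContMDiff 𝓘(ℝ, EY × ℂ) 𝓘(ℝ, EY) ∞ (Total.base : Z.Total → Y) := by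
  intro q
  have h1 : ContMDiffOn 𝓘(ℝ, EY × ℂ) 𝓘(ℝ, EY) ∞ (fun q' : Z.Total => (chartAt EY q.base).symm
      ((Z.ochart q.base q').1)) {q' | q'.base ∈ Z.V q.base} := by
    refine (contMDiffOn_chart_symm (I := 𝓘(ℝ, EY)) (x := q.base)).comp
      ((contDiff_fst (𝕜 := ℝ) (E := EY) (F := ℂ)).contMDiff.comp_contMDiffOn
        (contMDiffOn_ochart q.base)) ?_
    exact fun q' hq' => (chartAt EY q.base).map_source (Z.subset_chart _ hq')
  refine (h1.congr fun q' hq' => ?_).contMDiffAt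
    ((isOpen_base_preimage q.base).mem_nhds (Z.mem q.base))
  exact ((chartAt EY q.base).left_inv (Z.subset_chart _ hq')).symm

theorem contMDiffOn_coord (i : Y) : ContMDiffOn 𝓘(ℝ, EY × ℂ) 𝓘(ℝ, ℂ) ∞
    (coord i : Z.Total → ℂˣ) {q | q.base ∈ Z.V i} := by
  refine contMDiffOn_units ?_
  exact (contDiff_snd (𝕜 := ℝ) (E := EY) (F := ℂ)).contMDiff.comp_contMDiffOn
    (contMDiffOn_ochart i)

theorem contMDiffOn_point (i : Y) : ContMDiffOn (𝓘(ℝ, EY).prod 𝓘(ℝ, ℂ)) 𝓘(ℝ, EY × ℂ) ∞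
    (fun x : Y × ℂˣ => Z.point i x.1 x.2) (Z.V i ×ˢ univ) := by
  have h1 : ContMDiffOn (𝓘(ℝ, EY).prod 𝓘(ℝ, ℂ)) 𝓘(ℝ, EY × ℂ) ∞
      (fun x : Y × ℂˣ => (chartAt EY i x.1, (x.2 : ℂ))) (Z.V i ×ˢ univ) := by
    refine ContMDiffOn.prodMk_space ?_ ?_
    · exact (contMDiffOn_chart (I := 𝓘(ℝ, EY)) (x := i)).comp contMDiffOn_fst
        fun x hx => Z.subset_chart i hx.1
    · exact (Units.contMDiff_val (𝕜 := ℝ)).comp_contMDiffOn contMDiffOn_snd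
  have h2 : MapsTo (fun x : Y × ℂˣ => (chartAt EY i x.1, (x.2 : ℂ))) (Z.V i ×ˢ univ)
      (Z.ochart i).target := fun x hx =>
    (Z.chart i).map_source (x := Z.point i x.1 x.2) hx.1 |> fun h => by
      have : Z.chart i (Z.point i x.1 x.2) = (chartAt EY i x.1, (x.2 : ℂ)) := by
        change (chartAt EY i x.1, ((coord i (Z.point i x.1 x.2) : ℂˣ) : ℂ)) = _
        rw [coord_point hx.1]
      rwa [this] at h
  refine ((contMDiffOn_symm_of_mem_maximalAtlas (ochart_mem_maximalAtlas i)).comp h1 h2).congr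
    fun x hx => ?_
  change _ = Z.point i ((chartAt EY i).symm (chartAt EY i x.1)) (unitOf x.2)
  rw [(chartAt EY i).left_inv (Z.subset_chart i hx.1), unitOf_coe]

/-- The action fixes the base and multiplies the coordinate of any one trivialisation, so near `q`
it is read off in the trivialisation over `V q.base`. -/
theorem smul_contMDiff : ContMDiff (𝓘(ℝ, ℂ).prod 𝓘(ℝ, EY × ℂ)) 𝓘(ℝ, EY × ℂ) ∞
    (fun x : ℂˣ × Z.Total => x.1 • x.2) := by
  rintro ⟨z, q⟩
  have ho : IsOpen {x : ℂˣ × Z.Total | x.2.base ∈ Z.V q.base} :=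
    (isOpen_base_preimage q.base).preimage continuous_snd
  refine ContMDiffOn.contMDiffAt ?_ (ho.mem_nhds (Z.mem q.base))
  have h : ContMDiffOn (𝓘(ℝ, ℂ).prod 𝓘(ℝ, EY × ℂ)) (𝓘(ℝ, EY).prod 𝓘(ℝ, ℂ)) ∞
      (fun x : ℂˣ × Z.Total => (x.2.base, x.1 * coord q.base x.2))
      {x | x.2.base ∈ Z.V q.base} := by
    refine (contMDiff_base.comp_contMDiffOn contMDiffOn_snd).prodMk ?_
    exact contMDiffOn_fst.mul ((contMDiffOn_coord q.base).comp contMDiffOn_snd fun x hx => hx)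
  refine ((contMDiffOn_point q.base).comp h fun x hx => ⟨hx, mem_univ _⟩).congr fun x hx => ?_
  change _ = Z.point q.base x.2.base (x.1 * coord q.base x.2)
  rw [← smul_point, point_coord hx]

variable (Z) in
/-- The principal bundle glued from a cocycle. -/
noncomputable def principalBundle :
    PrincipalBundle 𝓘(ℝ, EY) (EY × ℂ) Z.Total (univ : Set Y) where
  proj := Total.base
  proj_mem _ := mem_univ _
  proj_smooth := contMDiff_base
  smul_smooth := smul_contMDiff
  proj_smul _ _ := rfl
  simply_transitive p q h := by
    obtain ⟨y, z⟩ := p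
    obtain ⟨y', w⟩ := q
    obtain rfl : y = y' := h
    refine ⟨z * w⁻¹, ?_, fun u hu => ?_⟩
    · change _ = (⟨y, z * w⁻¹ * w⟩ : Z.Total)
      rw [inv_mul_cancel_right]
    · have h : (⟨y, z⟩ : Z.Total) = ⟨y, u * w⟩ := hu
      rw [(Total.mk.inj h).2, mul_inv_cancel_right]
  locally_trivial y _ := by
    refine ⟨Z.V y, Z.isOpen y, Z.mem y, fun x => Z.point y x 1, coord y, ?_, fun _ _ => rfl,
      contMDiffOn_coord y, fun q hq => ?_⟩
    · exact (contMDiffOn_point y).comp (contMDiffOn_id.prodMk contMDiffOn_const)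
        fun x hx => ⟨hx.1, mem_univ _⟩
    · rw [smul_point, mul_one, point_coord hq]

end UnitsCocycle

end CocycleBundle


/-! ### Ratios of points in the fibres of a principal bundle -/

section PrincipalBundleLemmas

open Filter Set

variable {E : Type*} [NormedAddCommGroup E] [NormedSpace ℝ E]
  {H : Type*} [TopologicalSpace H] {I : ModelWithCorners ℝ E H}
  {X : Type*} [TopologicalSpace X] [ChartedSpace H X]
  {EP : Type*} [NormedAddCommGroup EP] [NormedSpace ℝ EP]
  {P : Type*} [TopologicalSpace P] [ChartedSpace EP P] [MulAction ℂˣ P] {S : Set X}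
  {F : Type*} [NormedAddCommGroup F] [NormedSpace ℝ F]
  {H' : Type*} [TopologicalSpace H'] {J : ModelWithCorners ℝ F H'}
  {N : Type*} [TopologicalSpace N] [ChartedSpace H' N]

namespace PrincipalBundle

variable (B : PrincipalBundle I EP P S)

theorem ratio_eq_of_eq_smul {p q : P} {z : ℂˣ} (h : p = z • q) : B.ratio p q = z := by
  have hp : B.proj p = B.proj q := by rw [h, B.proj_smul]
  exact (B.simply_transitive p q hp).unique (B.ratio_smul hp) h

theorem smul_left_cancel (B : PrincipalBundle I EP P S) {p : P} {z w : ℂˣ} (h : z • p = w • p) : z = w :=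
  (B.simply_transitive (z • p) p (B.proj_smul z p)).unique rfl h

theorem exists_proj_eq {x : X} (hx : x ∈ S) : ∃ p, B.proj p = x := by
  obtain ⟨W, -, hxW, σ, c, -, hσ, -⟩ := B.locally_trivial x hx
  exact ⟨σ x, hσ x ⟨hxW, hx⟩⟩

theorem contMDiffWithinAt_smul (B : PrincipalBundle I EP P S) {z : N → ℂˣ} {p : N → P}
    {s : Set N} {x : N} (hz : ContMDiffWithinAt J 𝓘(ℝ, ℂ) ∞ z s x) (hp : ContMDiffWithinAt J 𝓘(ℝ, EP) ∞ p s x) :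
    ContMDiffWithinAt J 𝓘(ℝ, EP) ∞ (fun y => z y • p y) s x :=
  (B.smul_smooth.contMDiffAt (x := (z x, p x))).comp_contMDiffWithinAt x (hz.prodMk hp)

/-- In a local trivialisation with fibre coordinate `c` the ratio is `c p / c q`. The version within
a set is needed for maps defined on fibre products, which are treated as subsets. -/
theorem contMDiffWithinAt_ratio {p q : N → P} {s : Set N} {x : N}
    (hp : ContMDiffWithinAt J 𝓘(ℝ, EP) ∞ p s x) (hq : ContMDiffWithinAt J 𝓘(ℝ, EP) ∞ q s x)
    (hpq : ∀ y ∈ s, B.proj (p y) = B.proj (q y)) (hx : x ∈ s) :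
    ContMDiffWithinAt J 𝓘(ℝ, ℂ) ∞ (fun y => B.ratio (p y) (q y)) s x := by
  obtain ⟨W, hW, hxW, σ, c, -, -, hc, hcσ⟩ := B.locally_trivial (B.proj (p x)) (B.proj_mem _)
  have hoW : IsOpen (B.proj ⁻¹' W) := hW.preimage B.proj_smooth.continuous
  have hxW' : q x ∈ B.proj ⁻¹' W := by
    rw [mem_preimage, ← hpq x hx]
    exact hxW
  have h1 : ContMDiffWithinAt J 𝓘(ℝ, ℂ) ∞ (fun y => c (p y)) s x :=
    (hc.contMDiffAt (hoW.mem_nhds hxW)).comp_contMDiffWithinAt x hp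
  have h2 : ContMDiffWithinAt J 𝓘(ℝ, ℂ) ∞ (fun y => c (q y)) s x :=
    (hc.contMDiffAt (hoW.mem_nhds hxW')).comp_contMDiffWithinAt x hq
  have h3 : ∀ y ∈ s, B.proj (p y) ∈ W → B.ratio (p y) (q y) = c (p y) * (c (q y))⁻¹ := by
    intro y hy hyW
    apply B.ratio_eq_of_eq_smul
    have e1 := hcσ (p y) hyW
    rw [hpq y hy] at hyW e1
    have e2 := hcσ (q y) hyW
    calc p y = (c (p y) * (c (q y))⁻¹) • (c (q y) • σ (B.proj (q y))) := by
          rw [smul_smul, inv_mul_cancel_right, ← e1]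
      _ = _ := by rw [← e2]
  refine (h1.mul h2.inv).congr_of_eventuallyEq ?_ (h3 x hx hxW)
  filter_upwards [self_mem_nhdsWithin, hp.continuousWithinAt.eventually (hoW.mem_nhds hxW)]
    with y hy hyW using h3 y hy hyW

end PrincipalBundle

end PrincipalBundleLemmas

/-! ### Left division in a bundle gerbe -/

section GerbeLemmas

open Filter Set

variable {EM : Type*} [NormedAddCommGroup EM] [NormedSpace ℝ EM]
  {M : Type*} [TopologicalSpace M] [ChartedSpace EM M]
  {EY : Type*} [NormedAddCommGroup EY] [NormedSpace ℝ EY]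
  {Y : Type*} [TopologicalSpace Y] [ChartedSpace EY Y]
  {EP : Type*} [NormedAddCommGroup EP] [NormedSpace ℝ EP]
  {P : Type*} [TopologicalSpace P] [ChartedSpace EP P] [MulAction ℂˣ P]
  {π : Y → M}
  {F : Type*} [NormedAddCommGroup F] [NormedSpace ℝ F]
  {H' : Type*} [TopologicalSpace H'] {J : ModelWithCorners ℝ F H'}
  {N : Type*} [TopologicalSpace N] [ChartedSpace H' N]

namespace BundleGerbe

variable (G : BundleGerbe EM EY EP P π)

theorem proj_eq (p : P) : G.bundle.proj p = (G.src p, G.tgt p) := rfl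

theorem π_src (p : P) : π (G.src p) = π (G.tgt p) := G.bundle.proj_mem p

@[simp] theorem src_smul (z : ℂˣ) (p : P) : G.src (z • p) = G.src p := by
  simp only [src, G.bundle.proj_smul]

@[simp] theorem tgt_smul (z : ℂˣ) (p : P) : G.tgt (z • p) = G.tgt p := by
  simp only [tgt, G.bundle.proj_smul]

theorem src_mul {p q : P} (h : G.tgt p = G.src q) : G.src (G.mul p q) = G.src p :=
  congrArg Prod.fst (a₂ := ((G.bundle.proj p).1, (G.bundle.proj q).2)) (G.proj_mul p q h)

theorem tgt_mul {p q : P} (h : G.tgt p = G.src q) : G.tgt (G.mul p q) = G.tgt q :=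
  congrArg Prod.snd (a₂ := ((G.bundle.proj p).1, (G.bundle.proj q).2)) (G.proj_mul p q h)

theorem smul_mul {p q : P} (z : ℂˣ) (h : G.tgt p = G.src q) :
    G.mul (z • p) q = z • G.mul p q := by
  simpa using G.smul_mul_smul z 1 p q h

theorem mul_smul {p q : P} (z : ℂˣ) (h : G.tgt p = G.src q) :
    G.mul p (z • q) = z • G.mul p q := by
  simpa using G.smul_mul_smul 1 z p q h

theorem exists_smul_eq {p q : P} (h1 : G.src p = G.src q) (h2 : G.tgt p = G.tgt q) :
    ∃ z : ℂˣ, p = z • q :=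
  ⟨_, G.bundle.ratio_smul (Prod.ext h1 h2)⟩

/-- The two candidates lie in the same fibre, so they differ by a scalar; equivariance moves it out
of the product, where freeness of the action forces it to be `1`. -/
theorem mul_left_cancel {p r r' : P} (h : G.tgt p = G.src r) (h' : G.tgt p = G.src r')
    (e : G.mul p r = G.mul p r') : r = r' := by
  have ht : G.tgt r = G.tgt r' := by rw [← G.tgt_mul h, e, G.tgt_mul h']
  obtain ⟨z, rfl⟩ := G.exists_smul_eq (h.symm.trans h') ht
  rw [G.mul_smul z h'] at e
  have hz : z = 1 := G.bundle.smul_left_cancel (by rw [e, one_smul])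
  rw [hz, one_smul]

/-- Any `r₀` over `(tgt p, tgt q)` gives a product `p r₀` in the fibre of `q`; rescaling `r₀` by the
ratio makes it equal to `q`. Division thus needs neither units nor inverses in `P`. -/
theorem exists_mul_eq {p q : P} (h : G.src p = G.src q) :
    ∃ r, G.src r = G.tgt p ∧ G.tgt r = G.tgt q ∧ G.mul p r = q := by
  obtain ⟨r₀, hr₀⟩ := G.bundle.exists_proj_eq (x := (G.tgt p, G.tgt q)) (by
    change π _ = π _
    rw [← G.π_src, ← G.π_src, h])
  have h1 : G.src r₀ = G.tgt p := congrArg Prod.fst (a₂ := (G.tgt p, G.tgt q)) hr₀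
  have h2 : G.tgt r₀ = G.tgt q := congrArg Prod.snd (a₂ := (G.tgt p, G.tgt q)) hr₀
  obtain ⟨z, hz⟩ := G.exists_smul_eq (p := q) (q := G.mul p r₀)
    (by rw [G.src_mul h1.symm, h]) (by rw [G.tgt_mul h1.symm, h2])
  exact ⟨z • r₀, by simpa using h1, by simpa using h2, by rw [G.mul_smul z h1.symm, ← hz]⟩

open Classical in
/-- The quotient `p⁻¹ q`, the unique `r` with `p r = q`; it has a meaning if `src p = src q`. -/
noncomputable def ldiv (p q : P) : P :=
  if h : G.src p = G.src q then (G.exists_mul_eq h).choose else p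

theorem ldiv_spec {p q : P} (h : G.src p = G.src q) :
    G.src (G.ldiv p q) = G.tgt p ∧ G.tgt (G.ldiv p q) = G.tgt q ∧ G.mul p (G.ldiv p q) = q := by
  unfold ldiv
  rw [dif_pos h]
  exact (G.exists_mul_eq h).choose_spec

theorem eq_ldiv {p q r : P} (hr : G.tgt p = G.src r) (e : G.mul p r = q) : r = G.ldiv p q := by
  have h : G.src p = G.src q := by rw [← e, G.src_mul hr]
  obtain ⟨h1, -, h3⟩ := G.ldiv_spec h
  exact G.mul_left_cancel hr h1.symm (e.trans h3.symm)

theorem contMDiff_src : ContMDiff 𝓘(ℝ, EP) 𝓘(ℝ, EY) ∞ G.src :=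
  contMDiff_fst.comp G.bundle.proj_smooth

theorem contMDiff_tgt : ContMDiff 𝓘(ℝ, EP) 𝓘(ℝ, EY) ∞ G.tgt :=
  contMDiff_snd.comp G.bundle.proj_smooth

theorem contMDiff_π (G : BundleGerbe EM EY EP P π) : ContMDiff 𝓘(ℝ, EY) 𝓘(ℝ, EM) ∞ π :=
  fun y => (G.submersion y).contMDiffAt

theorem contMDiffWithinAt_mul {p q : N → P} {s : Set N} {x : N}
    (hp : ContMDiffWithinAt J 𝓘(ℝ, EP) ∞ p s x) (hq : ContMDiffWithinAt J 𝓘(ℝ, EP) ∞ q s x)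
    (hpq : ∀ y ∈ s, G.tgt (p y) = G.src (q y)) (hx : x ∈ s) :
    ContMDiffWithinAt J 𝓘(ℝ, EP) ∞ (fun y => G.mul (p y) (q y)) s x :=
  (G.mul_smooth (p x, q x) (hpq x hx)).comp (t := {x : P × P | G.tgt x.1 = G.src x.2}) x (hp.prodMk hq) hpq

/-- This is the construction of `exists_mul_eq` with `r₀` given by a smooth local section `σ` of
`P`: locally `p⁻¹ q = ratio(q, p σ) • σ`. -/
theorem contMDiffWithinAt_ldiv {p q : N → P} {s : Set N} {x : N}
    (hp : ContMDiffWithinAt J 𝓘(ℝ, EP) ∞ p s x) (hq : ContMDiffWithinAt J 𝓘(ℝ, EP) ∞ q s x)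
    (hpq : ∀ y ∈ s, G.src (p y) = G.src (q y)) (hx : x ∈ s) :
    ContMDiffWithinAt J 𝓘(ℝ, EP) ∞ (fun y => G.ldiv (p y) (q y)) s x := by
  have hS : ∀ y ∈ s, (G.tgt (p y), G.tgt (q y)) ∈ fibreSquare π := fun y hy => by
    change π _ = π _
    rw [← G.π_src, ← G.π_src, hpq y hy]
  obtain ⟨W, hW, hxW, σ, -, hσ, hσ', -⟩ := G.bundle.locally_trivial _ (hS x hx)
  have hr : ContMDiffWithinAt J (𝓘(ℝ, EY).prod 𝓘(ℝ, EY)) ∞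
      (fun y => (G.tgt (p y), G.tgt (q y))) s x :=
    (G.contMDiff_tgt.contMDiffAt.comp_contMDiffWithinAt x hp).prodMk
      (G.contMDiff_tgt.contMDiffAt.comp_contMDiffWithinAt x hq)
  let s' : Set N := s ∩ (fun y => (G.tgt (p y), G.tgt (q y))) ⁻¹' W
  have hs' : s' ∈ 𝓝[s] x := inter_mem self_mem_nhdsWithin
    (hr.continuousWithinAt (hW.mem_nhds hxW))
  have hss : s' ⊆ s := inter_subset_left
  have hτ : ContMDiffWithinAt J 𝓘(ℝ, EP) ∞ (fun y => σ (G.tgt (p y), G.tgt (q y))) s' x :=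
    (hσ (G.tgt (p x), G.tgt (q x)) ⟨hxW, hS x hx⟩).comp (t := W ∩ fibreSquare π) x (hr.mono hss)
      fun y hy => ⟨hy.2, hS y hy.1⟩
  have hpr : ∀ y ∈ s', G.bundle.proj (σ (G.tgt (p y), G.tgt (q y))) = (G.tgt (p y), G.tgt (q y)) :=
    fun y hy => hσ' _ ⟨hy.2, hS y hy.1⟩
  have hc : ∀ y ∈ s', G.tgt (p y) = G.src (σ (G.tgt (p y), G.tgt (q y))) := fun y hy =>
    (congrArg Prod.fst (hpr y hy)).symm
  have hm : ContMDiffWithinAt J 𝓘(ℝ, EP) ∞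
      (fun y => G.mul (p y) (σ (G.tgt (p y), G.tgt (q y)))) s' x :=
    G.contMDiffWithinAt_mul (hp.mono hss) hτ hc ⟨hx, hxW⟩
  have hproj : ∀ y ∈ s', G.bundle.proj (q y) =
      G.bundle.proj (G.mul (p y) (σ (G.tgt (p y), G.tgt (q y)))) := fun y hy => by
    rw [G.proj_eq, G.proj_eq, G.src_mul (hc y hy), G.tgt_mul (hc y hy), hpq y hy.1]
    exact Prod.ext rfl (congrArg Prod.snd (hpr y hy)).symm
  have hz := G.bundle.contMDiffWithinAt_ratio (hq.mono hss) hm hproj ⟨hx, hxW⟩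
  have key : ∀ y ∈ s', G.ldiv (p y) (q y) =
      G.bundle.ratio (q y) (G.mul (p y) (σ (G.tgt (p y), G.tgt (q y)))) •
        σ (G.tgt (p y), G.tgt (q y)) := fun y hy => by
    refine (G.eq_ldiv (by simpa using hc y hy) ?_).symm
    rw [G.mul_smul _ (hc y hy), ← G.bundle.ratio_smul (hproj y hy)]
  exact ((G.bundle.contMDiffWithinAt_smul hz hτ).congr key (key x ⟨hx, hxW⟩)).mono_of_mem_nhdsWithin
    hs'

end BundleGerbe

end GerbeLemmas

/-! ### Pulling a connection back along scalar multiples and products -/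

section ConnectionLemmas

open Filter Set

variable {E : Type*} [NormedAddCommGroup E] [NormedSpace ℝ E]
  {H : Type*} [TopologicalSpace H] {I : ModelWithCorners ℝ E H}
  {X : Type*} [TopologicalSpace X] [ChartedSpace H X]
  {EP : Type*} [NormedAddCommGroup EP] [NormedSpace ℝ EP]
  {P : Type*} [TopologicalSpace P] [ChartedSpace EP P] [MulAction ℂˣ P] {S : Set X}
  {F : Type*} [NormedAddCommGroup F] [NormedSpace ℝ F]
  {N : Type*} [TopologicalSpace N] [ChartedSpace F N]

theorem alternating_one_ext {x : N} {θ η : TangentSpace 𝓘(ℝ, F) x [⋀^Fin 1]→L[ℝ] ℂ}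
    (h : ∀ v : TangentSpace 𝓘(ℝ, F) x, θ ![v] = η ![v]) : θ = η := by
  ext v
  have hv : v = ![v 0] := by
    ext i
    rw [Subsingleton.elim i 0]
    rfl
  rw [hv]
  exact h _

theorem DForm.pullback_one_apply {P : Type*} [TopologicalSpace P] [ChartedSpace EP P]
    (θ : DForm EP 1 P) (f : N → P) (x : N)
    (v : TangentSpace 𝓘(ℝ, F) x) : (θ.pullback f : DForm F 1 N) x ![v] =
      θ (f x) ![mfderiv 𝓘(ℝ, F) 𝓘(ℝ, EP) f x v] := by
  change θ (f x) _ = _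
  congr 1
  ext i
  rw [Subsingleton.elim i 0]
  rfl

theorem dlog_apply (z : N → ℂˣ) (x : N) (v : TangentSpace 𝓘(ℝ, F) x) : (dlog z : DForm F 1 N) x ![v] =
    (((z x)⁻¹ : ℂˣ) : ℂ) * id (α := ℂ) (mfderiv 𝓘(ℝ, F) 𝓘(ℝ, ℂ) (fun y => (z y : ℂ)) x v) := rfl

/-- The chart of `ℂˣ` is the inclusion itself, so in charts this map is the identity near `z`. -/
theorem hasMFDerivAt_units_val (z : ℂˣ) :
    HasMFDerivAt 𝓘(ℝ, ℂ) 𝓘(ℝ, ℂ) (Units.val : ℂˣ → ℂ) z (ContinuousLinearMap.id ℝ ℂ) := by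
  refine ⟨Units.continuous_val.continuousAt, ?_⟩
  have h1 : writtenInExtChartAt 𝓘(ℝ, ℂ) 𝓘(ℝ, ℂ) z (Units.val : ℂˣ → ℂ) =ᶠ[𝓝 (z : ℂ)] id := by
    have : {w : ℂ | w ≠ 0} ∈ 𝓝 (z : ℂ) := isOpen_ne.mem_nhds z.ne_zero
    filter_upwards [this] with w hw
    have h : w ∈ (extChartAt 𝓘(ℝ, ℂ) z).target := by
      have := (extChartAt 𝓘(ℝ, ℂ) z).map_source (x := Units.mk0 w hw) (by simp)
      simpa [Units.chartAt_apply] using this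
    exact (extChartAt 𝓘(ℝ, ℂ) z).right_inv h
  exact ((hasFDerivAt_id (𝕜 := ℝ) (z : ℂ)).congr_of_eventuallyEq h1).hasFDerivWithinAt

theorem mfderiv_units_val {z : N → ℂˣ} {x : N} (hz : MDifferentiableAt 𝓘(ℝ, F) 𝓘(ℝ, ℂ) z x)
    (v : TangentSpace 𝓘(ℝ, F) x) :
    (mfderiv 𝓘(ℝ, F) 𝓘(ℝ, ℂ) (fun y => (z y : ℂ)) x v : ℂ) =
      (mfderiv 𝓘(ℝ, F) 𝓘(ℝ, ℂ) z x v : ℂ) := by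
  have h := ((hasMFDerivAt_units_val (z x)).comp x hz.hasMFDerivAt).mfderiv
  exact DFunLike.congr_fun h v

/-- The curve `η ↦ exp η • z • p` is the orbit map `w ↦ w • p` after `η ↦ exp η * z`, whose
derivative at `0` is multiplication by `z`. It expresses an arbitrary vector tangent to an orbit
through the fundamental field that occurs in `IsConnection.vertical`. -/
theorem mfderiv_exp_smul (B : PrincipalBundle I EP P S) (z : ℂˣ) (p : P) (ζ : ℂ) :
    (mfderiv 𝓘(ℝ, ℂ) 𝓘(ℝ, EP)
      (fun η : ℂ => Units.mk0 (Complex.exp η) (Complex.exp_ne_zero η) • z • p) 0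
        ((((z⁻¹ : ℂˣ) : ℂ)) * ζ : ℂ) : EP) =
      mfderiv 𝓘(ℝ, ℂ) 𝓘(ℝ, EP) (fun w : ℂˣ => w • p) z ζ := by
  let e : ℂ → ℂˣ := fun η => Units.mk0 (Complex.exp η) (Complex.exp_ne_zero η) * z
  have he0 : e 0 = z := Units.ext (by simp [e])
  have hval : HasFDerivAt (𝕜 := ℝ) (fun η : ℂ => (e η : ℂ))
      (((z : ℂ) • ContinuousLinearMap.id ℂ ℂ).restrictScalars ℝ) 0 := by
    have h : HasFDerivAt (𝕜 := ℂ) (fun η : ℂ => (e η : ℂ)) ((z : ℂ) • ContinuousLinearMap.id ℂ ℂ) 0 := by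
      have h' := ((Complex.hasDerivAt_exp 0).mul_const (z : ℂ)).hasFDerivAt
      exact h'.congr_fderiv (by ext; simp)
    exact h.restrictScalars ℝ
  have he : ContMDiff 𝓘(ℝ, ℂ) 𝓘(ℝ, ℂ) ∞ e := by
    rw [← contMDiffOn_univ]
    refine contMDiffOn_units (ContMDiff.contMDiffOn (ContDiff.contMDiff ?_))
    exact Complex.contDiff_exp.mul contDiff_const
  have hde : MDifferentiableAt 𝓘(ℝ, ℂ) 𝓘(ℝ, ℂ) e 0 := he.mdifferentiableAt (by simp)
  have hs : MDifferentiableAt 𝓘(ℝ, ℂ) 𝓘(ℝ, EP) (fun w : ℂˣ => w • p) (e 0) :=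
    (B.smul_smooth.comp (contMDiff_id.prodMk contMDiff_const)).mdifferentiableAt (by simp)
  have h1 : (fun η : ℂ => Units.mk0 (Complex.exp η) (Complex.exp_ne_zero η) • z • p) =
      (fun w : ℂˣ => w • p) ∘ e := by
    funext η
    simp only [Function.comp, e, smul_smul]
  have h2 : (mfderiv 𝓘(ℝ, ℂ) 𝓘(ℝ, ℂ) e 0 ((((z⁻¹ : ℂˣ) : ℂ)) * ζ : ℂ) : ℂ) = ζ := by
    refine (mfderiv_units_val hde _).symm.trans ?_
    rw [mfderiv_eq_fderiv, hval.fderiv]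
    change (z : ℂ) * ((((z⁻¹ : ℂˣ) : ℂ)) * ζ) = ζ
    rw [← mul_assoc, Units.mul_inv, one_mul]
  rw [h1, mfderiv_comp 0 hs hde]
  change mfderiv 𝓘(ℝ, ℂ) 𝓘(ℝ, EP) (fun w : ℂˣ => w • p) (e 0)
    (mfderiv 𝓘(ℝ, ℂ) 𝓘(ℝ, ℂ) e 0 ((((z⁻¹ : ℂˣ) : ℂ)) * ζ : ℂ)) = _
  rw [h2]
  -- The equality `e 0 = z` is not definitional and the tangent spaces depend on it, so it is
  -- transported through a general `u`.
  have h3 : ∀ u, u = z → (mfderiv 𝓘(ℝ, ℂ) 𝓘(ℝ, EP) (fun w : ℂˣ => w • p) u ζ : EP) =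
      mfderiv 𝓘(ℝ, ℂ) 𝓘(ℝ, EP) (fun w : ℂˣ => w • p) z ζ := by
    rintro _ rfl
    rfl
  exact h3 _ he0

theorem DForm.map_add_one {P : Type*} [TopologicalSpace P] [ChartedSpace EP P]
    (θ : DForm EP 1 P) (p : P) (v w : TangentSpace 𝓘(ℝ, EP) p) :
    θ p ![v + w] = θ p ![v] + θ p ![w] := by
  have h : ∀ u : TangentSpace 𝓘(ℝ, EP) p, θ p ![u] =
      (ContinuousAlternatingMap.ofSubsingleton ℝ (TangentSpace 𝓘(ℝ, EP) p) ℂ (0 : Fin 1)).symm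
        (θ p) u := fun u => by
    change _ = θ p (fun _ => u)
    congr 1
    ext i
    rw [Subsingleton.elim i 0]
    rfl
  rw [h, h, h, map_add]

/-- The value of a 1-form on the vertical vector field, as a pull-back along the orbit. -/
theorem pullback_exp_smul (A : DForm EP 1 P) (p : P) (ξ : ℂ) :
    (A.pullback (fun η : ℂ => Units.mk0 (Complex.exp η) (Complex.exp_ne_zero η) • p) :
      DForm ℂ 1 ℂ) 0 ![ξ] = A p ![mfderiv 𝓘(ℝ, ℂ) 𝓘(ℝ, EP)
        (fun η : ℂ => Units.mk0 (Complex.exp η) (Complex.exp_ne_zero η) • p) 0 ξ] := by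
  have h : ∀ (p' : P) (v : EP), p' = p → A p' ![v] = A p ![v] := by
    rintro _ v rfl
    rfl
  refine (DForm.pullback_one_apply A _ _ _).trans (h _ _ ?_)
  have h1 : Units.mk0 (Complex.exp 0) (Complex.exp_ne_zero 0) = 1 := Units.ext (by simp)
  rw [h1, one_smul]

/-- The derivative of `z • p` splits into the two partial derivatives of the action. The variation
of `z` is vertical and contributes `z⁻¹ dz`; the variation of `p` contributes `p^* A` by invariance.
-/
theorem IsConnection.pullback_smul (B : PrincipalBundle I EP P S) {A : DForm EP 1 P}
    (hA : IsConnection A) {z : N → ℂˣ} {p : N → P} {x : N}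
    (hz : MDifferentiableAt 𝓘(ℝ, F) 𝓘(ℝ, ℂ) z x) (hp : MDifferentiableAt 𝓘(ℝ, F) 𝓘(ℝ, EP) p x) :
    (A.pullback (fun y => z y • p y) : DForm F 1 N) x =
      dlog z x + (A.pullback p : DForm F 1 N) x := by
  have hs : MDifferentiableAt (𝓘(ℝ, ℂ).prod 𝓘(ℝ, EP)) 𝓘(ℝ, EP) (fun x : ℂˣ × P => x.1 • x.2)
      (z x, p x) := B.smul_smooth.mdifferentiableAt (by simp)
  refine alternating_one_ext (x := x) fun v => ?_
  rw [DForm.pullback_one_apply]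
  change _ = (dlog z : DForm F 1 N) x ![v] + (A.pullback p : DForm F 1 N) x ![v]
  rw [DForm.pullback_one_apply, dlog_apply]
  have h1 : mfderiv 𝓘(ℝ, F) 𝓘(ℝ, EP) (fun y => z y • p y) x v =
      mfderiv (𝓘(ℝ, ℂ).prod 𝓘(ℝ, EP)) 𝓘(ℝ, EP) (fun x : ℂˣ × P => x.1 • x.2) (z x, p x)
        (mfderiv 𝓘(ℝ, F) 𝓘(ℝ, ℂ) z x v, mfderiv 𝓘(ℝ, F) 𝓘(ℝ, EP) p x v) :=
    DFunLike.congr_fun (HasMFDerivAt.comp (g := fun x : ℂˣ × P => x.1 • x.2)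
      (f := fun y => (z y, p y)) x hs.hasMFDerivAt
      (hz.hasMFDerivAt.prodMk hp.hasMFDerivAt)).mfderiv v
  refine (congrArg (fun w => A (z x • p x) ![w])
    (h1.trans (mfderiv_prod_eq_add_apply hs))).trans ?_
  refine (DForm.map_add_one A (z x • p x) _ _).trans (congrArg₂ (· + ·) ?_ ?_)
  · have h2 := mfderiv_exp_smul B (z x) (p x) (mfderiv 𝓘(ℝ, F) 𝓘(ℝ, ℂ) z x v)
    refine (congrArg (fun w => A (z x • p x) ![w]) h2.symm).trans ((hA.vertical _ _).trans ?_)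
    exact congrArg (fun w : ℂ => (((z x)⁻¹ : ℂˣ) : ℂ) * w) (mfderiv_units_val hz v).symm
  · have h2 := DFunLike.congr_fun (congrFun (hA.invariant (z x)) (p x))
      ![mfderiv 𝓘(ℝ, F) 𝓘(ℝ, EP) p x v]
    rwa [DForm.pullback_one_apply] at h2

/-- Turns the pointwise compatibility, stated for derivatives within `composable`, into a rule for
maps. Differentiating `tgt ∘ p = src ∘ q` shows that the velocities are tangent to `composable`,
which is why the equation is required in a neighbourhood of `x`. -/
theorem BundleGerbe.IsGerbeConnection.pullback_mul
    {EM : Type*} [NormedAddCommGroup EM] [NormedSpace ℝ EM]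
    {M : Type*} [TopologicalSpace M] [ChartedSpace EM M]
    {EY : Type*} [NormedAddCommGroup EY] [NormedSpace ℝ EY]
    {Y : Type*} [TopologicalSpace Y] [ChartedSpace EY Y] {π : Y → M}
    {G : BundleGerbe EM EY EP P π} {A : DForm EP 1 P} (hA : G.IsGerbeConnection A)
    {p q : N → P} {x : N} (hp : MDifferentiableAt 𝓘(ℝ, F) 𝓘(ℝ, EP) p x)
    (hq : MDifferentiableAt 𝓘(ℝ, F) 𝓘(ℝ, EP) q x) (hpq : ∀ᶠ y in 𝓝 x, G.tgt (p y) = G.src (q y)) :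
    (A.pullback (fun y => G.mul (p y) (q y)) : DForm F 1 N) x =
      (A.pullback p : DForm F 1 N) x + (A.pullback q : DForm F 1 N) x := by
  have hc : (p x, q x) ∈ G.composable := hpq.self_of_nhds
  have hm : MDifferentiableWithinAt (𝓘(ℝ, EP).prod 𝓘(ℝ, EP)) 𝓘(ℝ, EP)
      (fun x : P × P => G.mul x.1 x.2) G.composable (p x, q x) :=
    (G.mul_smooth _ hc).mdifferentiableWithinAt (by simp)
  refine alternating_one_ext (x := x) fun v => ?_
  change _ = (A.pullback p : DForm F 1 N) x ![v] + (A.pullback q : DForm F 1 N) x ![v]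
  rw [DForm.pullback_one_apply, DForm.pullback_one_apply, DForm.pullback_one_apply]
  have h1 := (HasMFDerivWithinAt.comp (g := fun x : P × P => G.mul x.1 x.2)
    (f := fun y => (p y, q y)) x hm.hasMFDerivWithinAt
    (hp.hasMFDerivAt.prodMk hq.hasMFDerivAt).hasMFDerivWithinAt
    (s := {y | G.tgt (p y) = G.src (q y)}) fun y hy => hy).hasMFDerivAt hpq
  have h2 : (mfderiv 𝓘(ℝ, EP) 𝓘(ℝ, EY) G.tgt (p x) (mfderiv 𝓘(ℝ, F) 𝓘(ℝ, EP) p x v) : EY) =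
      mfderiv 𝓘(ℝ, EP) 𝓘(ℝ, EY) G.src (q x) (mfderiv 𝓘(ℝ, F) 𝓘(ℝ, EP) q x v) := by
    have e1 := mfderiv_comp x (G.contMDiff_tgt.mdifferentiableAt (x := p x) (by simp)) hp
    have e2 := mfderiv_comp x (G.contMDiff_src.mdifferentiableAt (x := q x) (by simp)) hq
    have e3 : mfderiv 𝓘(ℝ, F) 𝓘(ℝ, EY) (G.tgt ∘ p) x = mfderiv 𝓘(ℝ, F) 𝓘(ℝ, EY) (G.src ∘ q) x :=
      EventuallyEq.mfderiv_eq hpq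
    exact (DFunLike.congr_fun e1 v).symm.trans
      ((DFunLike.congr_fun e3 v).trans (DFunLike.congr_fun e2 v))
  rw [← hA.mul_compatible _ _ hc _ hm.hasMFDerivWithinAt _ _ h2]
  exact congrArg (fun w => A (G.mul (p x) (q x)) ![w]) (DFunLike.congr_fun h1.mfderiv v)

end ConnectionLemmas


/-! ### Curves with prescribed velocity and their lifts along submersions -/

section Curves

open Filter Set

variable {E : Type*} [NormedAddCommGroup E] [NormedSpace ℝ E]
  {X : Type*} [TopologicalSpace X] [ChartedSpace E X]
  {E' : Type*} [NormedAddCommGroup E'] [NormedSpace ℝ E']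
  {X' : Type*} [TopologicalSpace X'] [ChartedSpace E' X']

theorem mdifferentiableAt_of_mem_maximalAtlas {φ : OpenPartialHomeomorph X E}
    (hφ : φ ∈ IsManifold.maximalAtlas 𝓘(ℝ, E) ∞ X) {x : X} (hx : x ∈ φ.source) :
    MDifferentiableAt 𝓘(ℝ, E) 𝓘(ℝ, E) φ x :=
  ((contMDiffOn_of_mem_maximalAtlas hφ).contMDiffAt
    (φ.open_source.mem_nhds hx)).mdifferentiableAt (by simp)

theorem mdifferentiableAt_symm_of_mem_maximalAtlas {φ : OpenPartialHomeomorph X E}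
    (hφ : φ ∈ IsManifold.maximalAtlas 𝓘(ℝ, E) ∞ X) {e : E} (he : e ∈ φ.target) :
    MDifferentiableAt 𝓘(ℝ, E) 𝓘(ℝ, E) φ.symm e :=
  ((contMDiffOn_symm_of_mem_maximalAtlas hφ).contMDiffAt
    (φ.open_target.mem_nhds he)).mdifferentiableAt (by simp)

/-- A curve given in a chart `φ` by `u`, with velocity `φ' w` at the point `φ x`, has velocity
`w`. -/
theorem mfderiv_symm_comp {φ : OpenPartialHomeomorph X E}
    (hφ : φ ∈ IsManifold.maximalAtlas 𝓘(ℝ, E) ∞ X) {x : X} (hx : x ∈ φ.source) (w : E) {u : ℝ → E}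
    (hu0 : u 0 = φ x) (hu : HasDerivAt u (mfderiv 𝓘(ℝ, E) 𝓘(ℝ, E) φ x w : E) 0) :
    MDifferentiableAt 𝓘(ℝ, ℝ) 𝓘(ℝ, E) (φ.symm ∘ u) 0 ∧
      (mfderiv 𝓘(ℝ, ℝ) 𝓘(ℝ, E) (φ.symm ∘ u) 0 (1 : ℝ) : E) = w := by
  have h0 : u 0 ∈ φ.target := hu0 ▸ φ.map_source hx
  have h1 := mdifferentiableAt_symm_of_mem_maximalAtlas hφ h0
  have h2 : MDifferentiableAt 𝓘(ℝ, ℝ) 𝓘(ℝ, E) u 0 := hu.differentiableAt.mdifferentiableAt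
  refine ⟨h1.comp 0 h2, ?_⟩
  have h3 := DFunLike.congr_fun (mfderiv_comp 0 h1 h2) (1 : ℝ)
  refine h3.trans ?_
  have h4 : (mfderiv 𝓘(ℝ, ℝ) 𝓘(ℝ, E) u 0 (1 : ℝ) : E) = mfderiv 𝓘(ℝ, E) 𝓘(ℝ, E) φ x w := by
    rw [mfderiv_eq_fderiv]
    exact hu.deriv
  have h5 := mfderiv_comp x
    (mdifferentiableAt_symm_of_mem_maximalAtlas hφ (φ.map_source hx))
    (mdifferentiableAt_of_mem_maximalAtlas hφ hx)
  have h6 : φ.symm ∘ φ =ᶠ[𝓝 x] id := by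
    filter_upwards [φ.open_source.mem_nhds hx] with y hy using φ.left_inv hy
  have h7 := DFunLike.congr_fun (h5.symm.trans (h6.mfderiv_eq.trans mfderiv_id)) w
  refine Eq.trans ?_ h7
  change mfderiv 𝓘(ℝ, E) 𝓘(ℝ, E) φ.symm (u 0) (mfderiv 𝓘(ℝ, ℝ) 𝓘(ℝ, E) u 0 (1 : ℝ)) = _
  refine (congrArg _ h4).trans ?_
  exact DFunLike.congr_fun (mfderiv_congr_point (I := 𝓘(ℝ, E)) (I' := 𝓘(ℝ, E)) (f := φ.symm) hu0)
    (mfderiv 𝓘(ℝ, E) 𝓘(ℝ, E) φ x w : E)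

theorem exists_curve [IsManifold 𝓘(ℝ, E) ∞ X] (x : X) (w : E) : ∃ c : ℝ → X, c 0 = x ∧
    MDifferentiableAt 𝓘(ℝ, ℝ) 𝓘(ℝ, E) c 0 ∧ (mfderiv 𝓘(ℝ, ℝ) 𝓘(ℝ, E) c 0 (1 : ℝ) : E) = w := by
  have hx := mem_chart_source E x
  let D : E := mfderiv 𝓘(ℝ, E) 𝓘(ℝ, E) (chartAt E x) x w
  have hu : HasDerivAt (fun t : ℝ => chartAt E x x + t • D) D 0 := by
    simpa using ((hasDerivAt_id (0 : ℝ)).smul_const D).const_add (chartAt E x x)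
  exact ⟨(chartAt E x).symm ∘ (fun t : ℝ => chartAt E x x + t • D), by simp,
    mfderiv_symm_comp (IsManifold.chart_mem_maximalAtlas x) hx w (by simp) hu⟩

/-- A curve in the base of a submersion has a lift through any point over its origin with any
velocity over the given one. -/
theorem exists_lift_curve {π : X → X'} {x : X}
    (hπ : Manifold.IsSubmersionAt 𝓘(ℝ, E) 𝓘(ℝ, E') ∞ π x)
    {γ : ℝ → X'} (hγ : MDifferentiableAt 𝓘(ℝ, ℝ) 𝓘(ℝ, E') γ 0) (hγ0 : γ 0 = π x) (w : E)
    (hw : (mfderiv 𝓘(ℝ, E) 𝓘(ℝ, E') π x w : E') = mfderiv 𝓘(ℝ, ℝ) 𝓘(ℝ, E') γ 0 (1 : ℝ)) :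
    ∃ c : ℝ → X, c 0 = x ∧ MDifferentiableAt 𝓘(ℝ, ℝ) 𝓘(ℝ, E) c 0 ∧
      (mfderiv 𝓘(ℝ, ℝ) 𝓘(ℝ, E) c 0 (1 : ℝ) : E) = w ∧ π ∘ c =ᶠ[𝓝 0] γ := by
  have hdπ : MDifferentiableAt 𝓘(ℝ, E) 𝓘(ℝ, E') π x := hπ.contMDiffAt.mdifferentiableAt (by simp)
  obtain ⟨F, _, _, h⟩ := hπ
  have hφ := h.domChart_mem_maximalAtlas
  have hψ := h.codChart_mem_maximalAtlas
  have hx := h.mem_domChart_source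
  have hπx := h.mem_codChart_source
  have hloc : ∀ e ∈ h.domChart.target,
      h.codChart (π (h.domChart.symm e)) = (h.equiv e).1 := fun e he => by
    have := h.writtenInCharts
      (show e ∈ (h.domChart.extend 𝓘(ℝ, E)).target by simpa using he)
    simpa using this
  have hmap := h.source_subset_preimage_source
  generalize h.domChart = φ at *
  generalize h.codChart = ψ at *
  generalize h.equiv = Φ at *
  let D : E := mfderiv 𝓘(ℝ, E) 𝓘(ℝ, E) φ x w
  -- In submersion charts `π` is the first projection of `E' × F`. The first coordinate of a lift
  -- must follow `ψ ∘ γ`; the second is free and is taken affine with the velocity that `w`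
  -- prescribes.
  let u : ℝ → E := fun t => Φ.symm (ψ (γ t), (Φ (φ x)).2 + t • (Φ D).2)
  have hu0 : u 0 = φ x := by
    have h1 := hloc (φ x) (φ.map_source hx)
    rw [φ.left_inv hx, ← hγ0] at h1
    simp only [u, zero_smul, add_zero, h1]
    exact Φ.symm_apply_apply _
  have hψγ : HasDerivAt (fun t => ψ (γ t)) (Φ D).1 0 := by
    have hγψ : MDifferentiableAt 𝓘(ℝ, E') 𝓘(ℝ, E') ψ (γ 0) :=
      mdifferentiableAt_of_mem_maximalAtlas hψ (hγ0 ▸ hπx)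
    have hd : DifferentiableAt ℝ (ψ ∘ γ) 0 := (hγψ.comp 0 hγ).differentiableAt
    -- The hypothesis `hw` makes the two prescriptions compatible: the first component of `Φ D` is
    -- the derivative of `ψ ∘ π` on `w`, which is the velocity of `ψ ∘ γ`.
    have h1 : (Φ D).1 = deriv (ψ ∘ γ) 0 := by
      have e1 := DFunLike.congr_fun (mfderiv_comp 0 hγψ hγ) (1 : ℝ)
      rw [mfderiv_eq_fderiv] at e1
      have e2 := DFunLike.congr_fun
        (mfderiv_comp x (mdifferentiableAt_of_mem_maximalAtlas hψ hπx) hdπ) w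
      have hΦ : DifferentiableAt ℝ (fun e => (Φ e).1) (φ x) :=
        (ContinuousLinearMap.fst ℝ E' F ∘L (Φ : E →L[ℝ] E' × F)).differentiableAt
      have e3 := DFunLike.congr_fun
        (mfderiv_comp x hΦ.mdifferentiableAt (mdifferentiableAt_of_mem_maximalAtlas hφ hx)) w
      have e4 : ψ ∘ π =ᶠ[𝓝 x] (fun e => (Φ e).1) ∘ φ := by
        filter_upwards [φ.open_source.mem_nhds hx] with y hy
        have := hloc (φ y) (φ.map_source hy)
        rwa [φ.left_inv hy] at this
      have e5 : (Φ D).1 = (mfderiv 𝓘(ℝ, E) 𝓘(ℝ, E') ((fun e => (Φ e).1) ∘ φ) x w : E') := by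
        refine Eq.trans ?_ e3.symm
        rw [mfderiv_eq_fderiv]
        have : fderiv ℝ (fun e => (Φ e).1) (φ x) =
            ContinuousLinearMap.fst ℝ E' F ∘L (Φ : E →L[ℝ] E' × F) :=
          (ContinuousLinearMap.fst ℝ E' F ∘L (Φ : E →L[ℝ] E' × F)).fderiv
        rw [this]
        rfl
      refine e5.trans ((DFunLike.congr_fun e4.mfderiv_eq w).symm.trans (e2.trans ?_))
      refine Eq.trans ?_ e1.symm
      change (mfderiv 𝓘(ℝ, E') 𝓘(ℝ, E') ψ (π x) (mfderiv 𝓘(ℝ, E) 𝓘(ℝ, E') π x w) : E') =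
        mfderiv 𝓘(ℝ, E') 𝓘(ℝ, E') ψ (γ 0) (mfderiv 𝓘(ℝ, ℝ) 𝓘(ℝ, E') γ 0 (1 : ℝ))
      refine (congrArg _ hw).trans ?_
      exact DFunLike.congr_fun (mfderiv_congr_point (I := 𝓘(ℝ, E')) (I' := 𝓘(ℝ, E')) (f := ψ)
        hγ0.symm) (mfderiv 𝓘(ℝ, ℝ) 𝓘(ℝ, E') γ 0 (1 : ℝ) : E')
    rw [h1]
    exact hd.hasDerivAt
  have hu : HasDerivAt u D 0 := by
    have h1 : HasDerivAt (fun t : ℝ => (Φ (φ x)).2 + t • (Φ D).2) (Φ D).2 0 := by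
      simpa using ((hasDerivAt_id (0 : ℝ)).smul_const (Φ D).2).const_add (Φ (φ x)).2
    have h2 := Φ.symm.hasFDerivAt.comp_hasDerivAt (0 : ℝ) (hψγ.prodMk h1)
    have h3 : Φ.symm ((Φ D).1, (Φ D).2) = D := Φ.symm_apply_apply D
    rw [← h3]
    exact h2
  obtain ⟨h1, h2⟩ := mfderiv_symm_comp hφ hx w hu0 hu
  refine ⟨φ.symm ∘ u, by simp [hu0, hx], h1, h2, ?_⟩
  have hu' : ∀ᶠ t in 𝓝 0, u t ∈ φ.target :=
    hu.continuousAt.eventually (φ.open_target.mem_nhds (hu0 ▸ φ.map_source hx))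
  have hγ' : ∀ᶠ t in 𝓝 0, γ t ∈ ψ.source :=
    hγ.continuousAt.eventually (ψ.open_source.mem_nhds (hγ0 ▸ hπx))
  filter_upwards [hu', hγ'] with t ht ht'
  have h3 := hloc (u t) ht
  simp only [u, Φ.apply_symm_apply] at h3
  exact ψ.injOn (hmap (φ.map_target ht)) ht' h3

end Curves

/-- In the chart over `V q.base` and the chart of `Y` at `q.base` the map is literally the
projection `EY × ℂ → EY`. -/
theorem UnitsCocycle.isSubmersionAt_base {EY : Type*} [NormedAddCommGroup EY] [NormedSpace ℝ EY]
    {Y : Type uY} [TopologicalSpace Y] [ChartedSpace EY Y] [IsManifold 𝓘(ℝ, EY) ∞ Y]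
    {Z : UnitsCocycle EY Y} (q : Z.Total) :
    Manifold.IsSubmersionAt 𝓘(ℝ, EY × ℂ) 𝓘(ℝ, EY) ∞ (Total.base : Z.Total → Y) q := by
  refine Manifold.IsSubmersionAt.mk_of_charts (F := ℂ) (ContinuousLinearEquiv.refl ℝ (EY × ℂ))
    (Z.ochart q.base) (chartAt EY q.base) (Z.mem q.base) (mem_chart_source EY q.base)
    (ochart_mem_maximalAtlas q.base) (IsManifold.chart_mem_maximalAtlas q.base)
    (fun q' hq' => Z.subset_chart q.base hq') fun e he => ?_
  have he' : e ∈ (Z.ochart q.base).target := by simpa using he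
  replace he' : e ∈ (Z.chart q.base).target := he'
  exact (chartAt EY q.base).right_inv he'.1.1


/-! ### From a vanishing Deligne class to the bundle `Q` and its maps to `P` -/

section SplittingSection

open Filter Set

variable {EM : Type*} [NormedAddCommGroup EM] [NormedSpace ℝ EM]
  {M : Type*} [TopologicalSpace M] [ChartedSpace EM M]
  {EY : Type*} [NormedAddCommGroup EY] [NormedSpace ℝ EY]
  {Y : Type uY} [TopologicalSpace Y] [ChartedSpace EY Y]
  {EP : Type*} [NormedAddCommGroup EP] [NormedSpace ℝ EP]
  {P : Type*} [TopologicalSpace P] [ChartedSpace EP P] [MulAction ℂˣ P]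
  {π : Y → M}

/-- Data over an open cover `U` of the base of a bundle gerbe: local sections `s α` of `Y → M`,
sections `ρ α β` of the pull-backs of `P` by `(s α, s β)` with `ρ α β * ρ β γ = ρ α γ`, and 1-forms
`k α` with `k β - k α = (ρ α β)^* A` and `d (k α) = (s α)^* f`. -/
structure BundleGerbe.Splitting (G : BundleGerbe EM EY EP P π) (A : DForm EP 1 P) (f : DForm EY 2 Y)
    (ι : Type*) where
  U : ι → Set M
  isOpen : ∀ α, IsOpen (U α)
  covers : ∀ x, ∃ α, x ∈ U α
  s : ι → M → Y
  s_smooth : ∀ α, ContMDiffOn 𝓘(ℝ, EM) 𝓘(ℝ, EY) ∞ (s α) (U α)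
  s_section : ∀ α, ∀ x ∈ U α, π (s α x) = x
  ρ : ι → ι → M → P
  ρ_smooth : ∀ α β, ContMDiffOn 𝓘(ℝ, EM) 𝓘(ℝ, EP) ∞ (ρ α β) (U α ∩ U β)
  src_ρ : ∀ {α β x}, x ∈ U α → x ∈ U β → G.src (ρ α β x) = s α x
  tgt_ρ : ∀ {α β x}, x ∈ U α → x ∈ U β → G.tgt (ρ α β x) = s β x
  ρ_mul_ρ : ∀ {α β γ x}, x ∈ U α → x ∈ U β → x ∈ U γ →
    G.mul (ρ α β x) (ρ β γ x) = ρ α γ x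
  k : ι → DForm EM 1 M
  k_smooth : ∀ α, (k α).SmoothOn (U α)
  pullback_ρ : ∀ {α β x}, x ∈ U α → x ∈ U β →
    (A.pullback (ρ α β) : DForm EM 1 M) x = k β x - k α x
  pullback_s : ∀ {α x}, x ∈ U α → (f.pullback (s α) : DForm EM 2 M) x = (k α).d x

/-- The vanishing of the class is used only here: dividing `σ α β` by `h α β` absorbs `g` into the
product and `dlog h` into the pull-back of `A`. -/
theorem BundleGerbe.LocalSections.exists_splitting {ι : Type*} {G : BundleGerbe EM EY EP P π}
    {A : DForm EP 1 P} (hA : IsConnection A) {f : DForm EY 2 Y} {𝒰 : LerayCover ι M}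
    (c : G.LocalSections 𝒰) (hD : (G.deligneCocycle c A f).ClassIsZero 𝒰) :
    Nonempty (G.Splitting A f ι) := by
  obtain ⟨b, hb, hE⟩ := hD
  have hsrc : ∀ {α β x}, x ∈ 𝒰.U α → x ∈ 𝒰.U β → G.src (c.σ α β x) = c.s α x := fun h h' =>
    congrArg Prod.fst (c.σ_section _ _ _ ⟨h, h'⟩)
  have htgt : ∀ {α β x}, x ∈ 𝒰.U α → x ∈ 𝒰.U β → G.tgt (c.σ α β x) = c.s β x := fun h h' =>
    congrArg Prod.snd (c.σ_section _ _ _ ⟨h, h'⟩)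
  have hρ : ∀ α β, ContMDiffOn 𝓘(ℝ, EM) 𝓘(ℝ, EP) ∞ (fun x => (b.h α β x)⁻¹ • c.σ α β x)
      (𝒰.U α ∩ 𝒰.U β) := fun α β x hx =>
    G.bundle.contMDiffWithinAt_smul (hb.smooth_h α β x hx).inv (c.σ_smooth α β x hx)
  exact ⟨{
    U := 𝒰.U
    isOpen := 𝒰.isOpen
    covers := fun x => mem_iUnion.1 (𝒰.covers ▸ mem_univ x)
    s := c.s
    s_smooth := c.s_smooth
    s_section := c.s_section
    ρ := fun α β x => (b.h α β x)⁻¹ • c.σ α β x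
    ρ_smooth := hρ
    src_ρ := fun h h' => by rw [G.src_smul, hsrc h h']
    tgt_ρ := fun h h' => by rw [G.tgt_smul, htgt h h']
    ρ_mul_ρ := fun {α β γ x} hα hβ hγ => by
      have hc : G.tgt (c.σ α β x) = G.src (c.σ β γ x) := by rw [htgt hα hβ, hsrc hβ hγ]
      have hp : G.bundle.proj (G.mul (c.σ α β x) (c.σ β γ x)) = G.bundle.proj (c.σ α γ x) := by
        rw [G.proj_eq, G.proj_eq, G.src_mul hc, G.tgt_mul hc, hsrc hα hβ, hsrc hα hγ,
          htgt hβ hγ, htgt hα hγ]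
      have hg : G.bundle.ratio (G.mul (c.σ α β x) (c.σ β γ x)) (c.σ α γ x) =
          b.h β γ x * (b.h α γ x)⁻¹ * b.h α β x := hE.g_eq α β γ x ⟨⟨hα, hβ⟩, hγ⟩
      rw [G.smul_mul_smul _ _ _ _ hc, G.bundle.ratio_smul hp, hg, smul_smul]
      congr 1
      rw [← mul_inv, inv_mul_eq_iff_eq_mul]
      ac_rfl
    k := b.k
    k_smooth := hb.smooth_k
    pullback_ρ := fun {α β x} hα hβ => by
      have ho := ((𝒰.isOpen α).inter (𝒰.isOpen β)).mem_nhds ⟨hα, hβ⟩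
      have h1 : A.pullback (c.σ α β) x = dlog (b.h α β) x + (b.k β x - b.k α x) :=
        hE.A_eq α β x ⟨hα, hβ⟩
      -- Applied to `σ = h • ρ` rather than to `ρ = h⁻¹ • σ`, so that `dlog h` itself appears and
      -- cancels against `h1`.
      have h2 := hA.pullback_smul G.bundle
        (((hb.smooth_h α β).contMDiffAt ho).mdifferentiableAt (by simp))
        (((hρ α β).contMDiffAt ho).mdifferentiableAt (by simp))
      simp only [smul_inv_smul] at h2
      exact add_left_cancel (h2.symm.trans h1)
    pullback_s := fun {α x} hα => hE.f_eq α x hα }⟩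

namespace BundleGerbe.Splitting

variable {G : BundleGerbe EM EY EP P π} {A : DForm EP 1 P} {f : DForm EY 2 Y} {ι : Type*}
  (T : G.Splitting A f ι)

/-- The index of a set of the cover containing `π y`. -/
noncomputable def idx (y : Y) : ι := (T.covers (π y)).choose

theorem idx_mem (y : Y) : π y ∈ T.U (T.idx y) := (T.covers (π y)).choose_spec

/-- A local section of `P` near `(s α (π y₀), y₀)` is composed with `j`, which maps into the fibre
product because `s α` is a section of `π`. The neighbourhood is shrunk into a chart domain as
`UnitsCocycle` demands. -/
theorem exists_local_section (y₀ : Y) : ∃ (V : Set Y) (τ : Y → P), IsOpen V ∧ y₀ ∈ V ∧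
    V ⊆ (chartAt EY y₀).source ∧ (∀ y ∈ V, π y ∈ T.U (T.idx y₀)) ∧
    ContMDiffOn 𝓘(ℝ, EY) 𝓘(ℝ, EP) ∞ τ V ∧ (∀ y ∈ V, G.src (τ y) = T.s (T.idx y₀) (π y)) ∧
    ∀ y ∈ V, G.tgt (τ y) = y := by
  set α := T.idx y₀ with hα
  let V₀ : Set Y := π ⁻¹' T.U α
  have hV₀ : IsOpen V₀ := (T.isOpen α).preimage G.contMDiff_π.continuous
  let j : Y → Y × Y := fun y => (T.s α (π y), y)
  have hj : ContMDiffOn 𝓘(ℝ, EY) (𝓘(ℝ, EY).prod 𝓘(ℝ, EY)) ∞ j V₀ :=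
    ((T.s_smooth α).comp G.contMDiff_π.contMDiffOn fun y hy => hy).prodMk contMDiffOn_id
  have hjS : ∀ y ∈ V₀, j y ∈ fibreSquare π := fun y hy => T.s_section α _ hy
  obtain ⟨W, hW, hyW, σ, -, hσ, hσ', -⟩ :=
    G.bundle.locally_trivial (j y₀) (hjS y₀ (T.idx_mem y₀))
  have hV₁ : IsOpen (V₀ ∩ j ⁻¹' W) := hj.continuousOn.isOpen_inter_preimage hV₀ hW
  refine ⟨(V₀ ∩ j ⁻¹' W) ∩ (chartAt EY y₀).source, σ ∘ j, hV₁.inter (chartAt EY y₀).open_source,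
    ⟨⟨T.idx_mem y₀, hyW⟩, mem_chart_source EY y₀⟩, inter_subset_right, fun y hy => hy.1.1, ?_,
    ?_, ?_⟩
  · exact hσ.comp (hj.mono fun y hy => hy.1.1) fun y hy => ⟨hy.1.2, hjS y hy.1.1⟩
  · exact fun y hy => congrArg Prod.fst (hσ' (j y) ⟨hy.1.2, hjS y hy.1.1⟩)
  · exact fun y hy => congrArg Prod.snd (hσ' (j y) ⟨hy.1.2, hjS y hy.1.1⟩)

/-- A neighbourhood of `i` over which `P` has the section `T.τ i` of its pull-back by
`y ↦ (s α (π y), y)`, where `α = T.idx i`. -/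
noncomputable def V (i : Y) : Set Y := (T.exists_local_section i).choose

/-- A local section near `i` of the pull-back of `P` by `y ↦ (s α (π y), y)`, where
`α = T.idx i`. -/
noncomputable def τ (i : Y) : Y → P := (T.exists_local_section i).choose_spec.choose

theorem V_spec (i : Y) : IsOpen (T.V i) ∧ i ∈ T.V i ∧
    T.V i ⊆ (chartAt EY i).source ∧ (∀ y ∈ T.V i, π y ∈ T.U (T.idx i)) ∧
    ContMDiffOn 𝓘(ℝ, EY) 𝓘(ℝ, EP) ∞ (T.τ i) (T.V i) ∧
    (∀ y ∈ T.V i, G.src (T.τ i y) = T.s (T.idx i) (π y)) ∧ ∀ y ∈ T.V i, G.tgt (T.τ i y) = y :=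
  (T.exists_local_section i).choose_spec.choose_spec

theorem mem_V (i : Y) : i ∈ T.V i := (T.V_spec i).2.1

theorem π_mem {i y : Y} (h : y ∈ T.V i) : π y ∈ T.U (T.idx i) := (T.V_spec i).2.2.2.1 y h

theorem τ_smooth (i : Y) : ContMDiffOn 𝓘(ℝ, EY) 𝓘(ℝ, EP) ∞ (T.τ i) (T.V i) :=
  (T.V_spec i).2.2.2.2.1

theorem src_τ {i y : Y} (h : y ∈ T.V i) : G.src (T.τ i y) = T.s (T.idx i) (π y) :=
  (T.V_spec i).2.2.2.2.2.1 y h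

theorem tgt_τ {i y : Y} (h : y ∈ T.V i) : G.tgt (T.τ i y) = y :=
  (T.V_spec i).2.2.2.2.2.2 y h

theorem tgt_ρ_eq_src_τ {i y : Y} {α : ι} (hα : π y ∈ T.U α) (hi : y ∈ T.V i) :
    G.tgt (T.ρ α (T.idx i) (π y)) = G.src (T.τ i y) := by
  rw [T.tgt_ρ hα (T.π_mem hi), T.src_τ hi]

theorem proj_ρ_mul_τ {i j y : Y} (hi : y ∈ T.V i) (hj : y ∈ T.V j) :
    G.bundle.proj (G.mul (T.ρ (T.idx i) (T.idx j) (π y)) (T.τ j y)) = G.bundle.proj (T.τ i y) := by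
  have hc := T.tgt_ρ_eq_src_τ (T.π_mem hi) hj
  rw [G.proj_eq, G.proj_eq, G.src_mul hc, G.tgt_mul hc, T.src_ρ (T.π_mem hi) (T.π_mem hj),
    T.src_τ hi, T.tgt_τ hi, T.tgt_τ hj]

/-- The transition functions between the local sections `ρ * τ`. -/
noncomputable def t (i j y : Y) : ℂˣ :=
  G.bundle.ratio (G.mul (T.ρ (T.idx i) (T.idx j) (π y)) (T.τ j y)) (T.τ i y)

theorem ρ_mul_τ {i j y : Y} (hi : y ∈ T.V i) (hj : y ∈ T.V j) :
    G.mul (T.ρ (T.idx i) (T.idx j) (π y)) (T.τ j y) = T.t i j y • T.τ i y :=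
  G.bundle.ratio_smul (T.proj_ρ_mul_τ hi hj)

/-- Cancellation of the second factor in a product `ρ * ρ * p`. -/
theorem ρ_mul_ρ_mul {α β γ : ι} {x : M} {p : P} (hα : x ∈ T.U α) (hβ : x ∈ T.U β) (hγ : x ∈ T.U γ)
    (hp : G.src p = T.s γ x) :
    G.mul (T.ρ α β x) (G.mul (T.ρ β γ x) p) = G.mul (T.ρ α γ x) p := by
  rw [← T.ρ_mul_ρ hα hβ hγ]
  refine (G.mul_assoc _ _ _ ?_ ?_).symm
  · exact (T.tgt_ρ hα hβ).trans (T.src_ρ hβ hγ).symm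
  · exact (T.tgt_ρ hβ hγ).trans hp.symm

/-- The cocycle of a splitting. -/
noncomputable def cocycle : UnitsCocycle EY Y where
  V := T.V
  isOpen i := (T.V_spec i).1
  mem := T.mem_V
  subset_chart i := (T.V_spec i).2.2.1
  t := T.t
  smooth i j y hy := by
    have h1 : ContMDiffOn 𝓘(ℝ, EY) 𝓘(ℝ, EP) ∞ (fun y => T.ρ (T.idx i) (T.idx j) (π y))
        (T.V i ∩ T.V j) := (T.ρ_smooth _ _).comp G.contMDiff_π.contMDiffOn
      fun y hy => ⟨T.π_mem hy.1, T.π_mem hy.2⟩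
    refine G.bundle.contMDiffWithinAt_ratio (G.contMDiffWithinAt_mul (h1 y hy)
      ((T.τ_smooth j).mono inter_subset_right y hy) ?_ hy)
      ((T.τ_smooth i).mono inter_subset_left y hy) ?_ hy
    · exact fun y hy => T.tgt_ρ_eq_src_τ (T.π_mem hy.1) hy.2
    · exact fun y hy => T.proj_ρ_mul_τ hy.1 hy.2
  comp i j k y hi hj hk := by
    -- Evaluating `ρ_ij ρ_jk τ_k` in two ways gives `t_jk t_ij • τ_i = t_ik • τ_i`.
    have h := T.ρ_mul_ρ_mul (T.π_mem hi) (T.π_mem hj) (T.π_mem hk) (T.src_τ hk)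
    rw [T.ρ_mul_τ hj hk, T.ρ_mul_τ hi hk, G.mul_smul _ (T.tgt_ρ_eq_src_τ (T.π_mem hi) hj),
      T.ρ_mul_τ hi hj, smul_smul, mul_comm] at h
    exact G.bundle.smul_left_cancel h

/-- The map to `P` from the part of the glued bundle over `U β`, with values over
`(s β (π y), y)`. -/
noncomputable def p (β : ι) (q : T.cocycle.Total) : P :=
  G.mul (T.ρ β (T.idx q.base) (π q.base)) (q.fib • T.τ q.base q.base)

/-- The definition of `p` uses the trivialisation at `q.base`, a choice that need not vary
continuously with `q`. This formula in a fixed trivialisation `i` is what gives smoothness in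
`contMDiffAt_p`. -/
theorem p_eq {β : ι} {i : Y} {q : T.cocycle.Total} (hβ : π q.base ∈ T.U β) (hi : q.base ∈ T.V i) :
    T.p β q = G.mul (T.ρ β (T.idx i) (π q.base))
      (UnitsCocycle.coord i q • T.τ i q.base) := by
  have hq := T.mem_V q.base
  have hq' := T.π_mem hq
  change _ = G.mul _ ((T.t i q.base q.base * q.fib) • T.τ i q.base)
  rw [mul_comm, ← smul_smul, ← T.ρ_mul_τ hi hq, G.mul_smul, T.ρ_mul_ρ_mul hβ (T.π_mem hi) hq'
    (T.src_τ hq), p, G.mul_smul _ (T.tgt_ρ_eq_src_τ hβ hq)]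
  rw [G.src_mul (T.tgt_ρ_eq_src_τ (T.π_mem hi) hq), T.tgt_ρ hβ (T.π_mem hi),
    T.src_ρ (T.π_mem hi) hq']

theorem p_composable {β : ι} {q : T.cocycle.Total} (hβ : π q.base ∈ T.U β) :
    G.tgt (T.ρ β (T.idx q.base) (π q.base)) = G.src (q.fib • T.τ q.base q.base) := by
  rw [G.src_smul, T.tgt_ρ_eq_src_τ hβ (T.mem_V _)]

theorem src_p {β : ι} {q : T.cocycle.Total} (hβ : π q.base ∈ T.U β) :
    G.src (T.p β q) = T.s β (π q.base) := by
  rw [p, G.src_mul (T.p_composable hβ), T.src_ρ hβ (T.idx_mem _)]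

theorem tgt_p {β : ι} {q : T.cocycle.Total} (hβ : π q.base ∈ T.U β) :
    G.tgt (T.p β q) = q.base := by
  rw [p, G.tgt_mul (T.p_composable hβ), G.tgt_smul, T.tgt_τ (T.mem_V _)]

theorem p_smul {β : ι} {q : T.cocycle.Total} (z : ℂˣ) (hβ : π q.base ∈ T.U β) :
    T.p β (z • q) = z • T.p β q := by
  change G.mul (T.ρ β (T.idx q.base) (π q.base)) ((z * q.fib) • T.τ q.base q.base) = _
  rw [← smul_smul, G.mul_smul z (T.p_composable hβ)]
  rfl

/-- Changing the index multiplies on the left by an element depending only on the point of `M`. The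
independence of the index, both of the connection and of the isomorphism, rests on this. -/
theorem p_change {α β : ι} {q : T.cocycle.Total} (hα : π q.base ∈ T.U α) (hβ : π q.base ∈ T.U β) :
    T.p α q = G.mul (T.ρ α β (π q.base)) (T.p β q) := by
  rw [p, p, T.ρ_mul_ρ_mul hα hβ (T.idx_mem _)]
  rw [G.src_smul, T.src_τ (T.mem_V _)]

variable [IsManifold 𝓘(ℝ, EY) ∞ Y]

/-- The projection of the glued bundle to `M`. -/
noncomputable def toBase (q : T.cocycle.Total) : M := π q.base

theorem contMDiff_toBase : ContMDiff 𝓘(ℝ, EY × ℂ) 𝓘(ℝ, EM) ∞ T.toBase :=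
  G.contMDiff_π.comp UnitsCocycle.contMDiff_base

theorem isOpen_toBase_preimage (β : ι) : IsOpen {q : T.cocycle.Total | π q.base ∈ T.U β} :=
  (T.isOpen β).preimage T.contMDiff_toBase.continuous

theorem contMDiffAt_p {β : ι} {q : T.cocycle.Total} (hβ : π q.base ∈ T.U β) :
    ContMDiffAt 𝓘(ℝ, EY × ℂ) 𝓘(ℝ, EP) ∞ (T.p β) q := by
  set i := q.base with hi
  let s : Set T.cocycle.Total := {q | π q.base ∈ T.U β} ∩ {q | q.base ∈ T.V i}
  have hs : IsOpen s := (T.isOpen_toBase_preimage β).inter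
    (UnitsCocycle.isOpen_base_preimage (Z := T.cocycle) i)
  have hqs : q ∈ s := ⟨hβ, T.mem_V i⟩
  have hb := UnitsCocycle.contMDiff_base (Z := T.cocycle)
  have h1 : ContMDiffOn 𝓘(ℝ, EY × ℂ) 𝓘(ℝ, EP) ∞
      (fun q : T.cocycle.Total => T.ρ β (T.idx i) (π q.base)) s :=
    (T.ρ_smooth _ _).comp T.contMDiff_toBase.contMDiffOn fun q hq => ⟨hq.1, T.π_mem hq.2⟩
  have h2 : ContMDiffOn 𝓘(ℝ, EY × ℂ) 𝓘(ℝ, EP) ∞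
      (fun q : T.cocycle.Total => T.τ i q.base) s :=
    (T.τ_smooth i).comp hb.contMDiffOn fun q hq => hq.2
  have h3 := G.bundle.contMDiffWithinAt_smul
    ((UnitsCocycle.contMDiffOn_coord (Z := T.cocycle) i).mono inter_subset_right q hqs) (h2 q hqs)
  have h4 := G.contMDiffWithinAt_mul (h1 q hqs) h3 (fun q hq => by
    rw [G.src_smul, T.tgt_ρ_eq_src_τ hq.1 hq.2]) hqs
  exact (h4.congr (fun q hq => T.p_eq hq.1 hq.2) (T.p_eq hqs.1 hqs.2)).contMDiffAt
    (hs.mem_nhds hqs)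

end BundleGerbe.Splitting

end SplittingSection


/-! ### The connection on `Q` and its curvature -/

section Trivialisation

open Filter Set

variable {EM : Type*} [NormedAddCommGroup EM] [NormedSpace ℝ EM]
  {M : Type*} [TopologicalSpace M] [ChartedSpace EM M]
  {EY : Type*} [NormedAddCommGroup EY] [NormedSpace ℝ EY]
  {Y : Type uY} [TopologicalSpace Y] [ChartedSpace EY Y] [IsManifold 𝓘(ℝ, EY) ∞ Y]
  {EP : Type*} [NormedAddCommGroup EP] [NormedSpace ℝ EP]
  {P : Type*} [TopologicalSpace P] [ChartedSpace EP P] [MulAction ℂˣ P]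
  {π : Y → M} {G : BundleGerbe EM EY EP P π} {A : DForm EP 1 P} {f : DForm EY 2 Y} {ι : Type*}
  (T : G.Splitting A f ι)

namespace BundleGerbe.Splitting

/-! ### The connection -/

/-- The connection form `p^* A + k` on the glued bundle. -/
noncomputable def connection : DForm (EY × ℂ) 1 T.cocycle.Total := fun q =>
  (A.pullback (T.p (T.idx q.base)) : DForm (EY × ℂ) 1 T.cocycle.Total) q +
    ((T.k (T.idx q.base)).pullback T.toBase :
      DForm (EY × ℂ) 1 T.cocycle.Total) q

/-- The product rule for `A` applied to `p_change`; the factor `ρ α β ∘ π` contributes `π^*(k β - k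
α)`. -/
theorem pullback_p (hA : G.IsGerbeConnection A) {α β : ι} {q : T.cocycle.Total}
    (hα : π q.base ∈ T.U α) (hβ : π q.base ∈ T.U β) :
    (A.pullback (T.p α) : DForm (EY × ℂ) 1 T.cocycle.Total) q =
      (((T.k β).pullback T.toBase :
          DForm (EY × ℂ) 1 T.cocycle.Total) q -
        ((T.k α).pullback T.toBase :
          DForm (EY × ℂ) 1 T.cocycle.Total) q) +
      (A.pullback (T.p β) : DForm (EY × ℂ) 1 T.cocycle.Total) q := by
  have hn : ∀ᶠ q' in 𝓝 q, π q'.base ∈ T.U α ∧ π q'.base ∈ T.U β :=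
    inter_mem ((T.isOpen_toBase_preimage α).mem_nhds hα)
      ((T.isOpen_toBase_preimage β).mem_nhds hβ)
  have hπ := T.contMDiff_toBase.mdifferentiableAt (x := q) (by simp)
  have hρ : MDifferentiableAt 𝓘(ℝ, EM) 𝓘(ℝ, EP) (T.ρ α β) (T.toBase q) :=
    ((T.ρ_smooth α β).contMDiffAt (((T.isOpen α).inter (T.isOpen β)).mem_nhds
      ⟨hα, hβ⟩)).mdifferentiableAt (by simp)
  have h1 : T.p α =ᶠ[𝓝 q] fun q => G.mul (T.ρ α β (T.toBase q)) (T.p β q) := by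
    filter_upwards [hn] with q' hq' using T.p_change hq'.1 hq'.2
  have h2 := hA.pullback_mul (hρ.comp q hπ) ((T.contMDiffAt_p hβ).mdifferentiableAt (by simp))
    (hn.mono fun q' hq' => by
      rw [Function.comp, toBase, T.tgt_ρ hq'.1 hq'.2, T.src_p hq'.2])
  refine (DForm.pullback_congr_apply A h1).trans (h2.trans ?_)
  congr 1
  refine (DForm.pullback_comp_apply A hρ hπ).symm.trans ?_
  exact DForm.pullback_congr_form (η := T.k β - T.k α) (T.pullback_ρ hα hβ)

/-- The change of `k` cancels the change of `p^* A`. The index in the definition depends on the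
point; here it may be held fixed, so the form can be differentiated near a point. -/
theorem connection_eq (hA : G.IsGerbeConnection A) {α : ι} {q : T.cocycle.Total}
    (hα : π q.base ∈ T.U α) :
    T.connection q = (A.pullback (T.p α) +
      (T.k α).pullback T.toBase :
        DForm (EY × ℂ) 1 T.cocycle.Total) q := by
  rw [connection, T.pullback_p hA (T.idx_mem q.base) hα, Pi.add_apply]
  abel

theorem eventually_connection_eq (hA : G.IsGerbeConnection A) {α : ι} {q : T.cocycle.Total}
    (hα : π q.base ∈ T.U α) :
    ∀ᶠ q' in 𝓝 q, T.connection q' = (A.pullback (T.p α) +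
      (T.k α).pullback T.toBase :
        DForm (EY × ℂ) 1 T.cocycle.Total) q' := by
  filter_upwards [(T.isOpen_toBase_preimage α).mem_nhds hα] with q' hq'
    using T.connection_eq hA hq'

theorem smoothAt_connection [IsManifold 𝓘(ℝ, EM) ∞ M] [IsManifold 𝓘(ℝ, EP) ∞ P]
    (hA : G.IsGerbeConnection A) (q : T.cocycle.Total) : T.connection.SmoothAt q := by
  have hα := T.idx_mem q.base
  have h1 : (A.pullback (T.p (T.idx q.base)) : DForm (EY × ℂ) 1 T.cocycle.Total).SmoothAt q :=
    DForm.SmoothAt.pullback (hA.isConnection.smooth _) (T.contMDiffAt_p hα)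
  have h2 : ((T.k (T.idx q.base)).pullback T.toBase :
      DForm (EY × ℂ) 1 T.cocycle.Total).SmoothAt q :=
    DForm.SmoothAt.pullback (T.k_smooth _ _ hα) T.contMDiff_toBase.contMDiffAt
  exact DForm.SmoothAt.congr (h1.add h2) (T.eventually_connection_eq hA hα)

/-- For a fixed index, `p α` is equivariant and `A` is invariant, while the term in `k α` is pulled
back from `M`, on which the action has no effect. -/
theorem connection_invariant (hA : G.IsGerbeConnection A) (z : ℂˣ) :
    T.connection.pullback (fun q : T.cocycle.Total => z • q) = T.connection := by
  funext q
  obtain ⟨α, hα⟩ := T.covers (π q.base)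
  have hz : MDifferentiableAt 𝓘(ℝ, EY × ℂ) 𝓘(ℝ, EY × ℂ) (fun q : T.cocycle.Total => z • q) q :=
    (T.cocycle.principalBundle.contMDiffWithinAt_smul contMDiffWithinAt_const
      (contMDiffWithinAt_id (s := univ))).contMDiffAt univ_mem |>.mdifferentiableAt (by simp)
  have hz' : MDifferentiableAt 𝓘(ℝ, EP) 𝓘(ℝ, EP) (fun p : P => z • p) (T.p α q) :=
    (G.bundle.contMDiffWithinAt_smul contMDiffWithinAt_const
      (contMDiffWithinAt_id (s := univ))).contMDiffAt univ_mem |>.mdifferentiableAt (by simp)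
  have hp : ∀ q', π q'.base ∈ T.U α → MDifferentiableAt 𝓘(ℝ, EY × ℂ) 𝓘(ℝ, EP) (T.p α) q' :=
    fun q' h => (T.contMDiffAt_p h).mdifferentiableAt (by simp)
  have hb := T.contMDiff_toBase.mdifferentiableAt (x := z • q) (by simp)
  have h1 : (A.pullback (T.p α ∘ fun q => z • q) : DForm (EY × ℂ) 1 T.cocycle.Total) q =
      (A.pullback (T.p α) : DForm (EY × ℂ) 1 T.cocycle.Total) q := by
    have e : T.p α ∘ (fun q => z • q) =ᶠ[𝓝 q] (fun p => z • p) ∘ T.p α := by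
      filter_upwards [(T.isOpen_toBase_preimage α).mem_nhds hα] with q' hq' using T.p_smul z hq'
    rw [DForm.pullback_congr_apply A e, ← DForm.pullback_comp_apply A hz' (hp q hα),
      hA.isConnection.invariant z]
  refine (DForm.pullback_congr_form (T.connection_eq hA (q := z • q) hα)).trans ?_
  rw [T.connection_eq hA hα, DForm.pullback_add, Pi.add_apply, Pi.add_apply,
    DForm.pullback_comp_apply A (hp (z • q) hα) hz, h1, DForm.pullback_comp_apply (T.k α) hb hz]
  rfl

/-- By equivariance `p α` carries the orbit of `q` to the orbit of `p α q`, where `A` has the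
prescribed value; the term in `k α` vanishes because the orbit is constant in `M`. -/
theorem connection_vertical (hA : G.IsGerbeConnection A) (q : T.cocycle.Total) (ξ : ℂ) :
    T.connection q ![mfderiv 𝓘(ℝ, ℂ) 𝓘(ℝ, EY × ℂ)
      (fun η : ℂ => Units.mk0 (Complex.exp η) (Complex.exp_ne_zero η) • q) 0 ξ] = ξ := by
  obtain ⟨α, hα⟩ := T.covers (π q.base)
  let e : ℂ → T.cocycle.Total :=
    fun η => Units.mk0 (Complex.exp η) (Complex.exp_ne_zero η) • q
  have he : MDifferentiableAt 𝓘(ℝ, ℂ) 𝓘(ℝ, EY × ℂ) e 0 := by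
    have h : ContMDiff 𝓘(ℝ, ℂ) 𝓘(ℝ, ℂ) ∞
        (fun η => Units.mk0 (Complex.exp η) (Complex.exp_ne_zero η)) := by
      rw [← contMDiffOn_univ]
      exact contMDiffOn_units Complex.contDiff_exp.contMDiff.contMDiffOn
    exact (T.cocycle.principalBundle.contMDiffWithinAt_smul (h.contMDiffAt.contMDiffWithinAt (s := univ))
      contMDiffWithinAt_const).contMDiffAt univ_mem |>.mdifferentiableAt (by simp)
  refine (pullback_exp_smul T.connection q ξ).symm.trans ?_
  have h1 : (T.connection.pullback e : DForm ℂ 1 ℂ) 0 =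
      (A.pullback (T.p α ∘ e) : DForm ℂ 1 ℂ) 0 + ((T.k α).pullback (T.toBase ∘ e) :
        DForm ℂ 1 ℂ) 0 := by
    rw [DForm.pullback_congr_form (T.connection_eq hA (q := e 0) hα), DForm.pullback_add,
      Pi.add_apply, DForm.pullback_comp_apply A
        ((T.contMDiffAt_p (q := e 0) hα).mdifferentiableAt (by simp)) he,
      DForm.pullback_comp_apply (T.k α) (T.contMDiff_toBase.mdifferentiableAt (by simp)) he]
  have h2 : (T.p α ∘ e) =
      fun η => Units.mk0 (Complex.exp η) (Complex.exp_ne_zero η) • T.p α q := by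
    funext η
    exact T.p_smul _ hα
  have h3 : ((T.k α).pullback (T.toBase ∘ e) : DForm ℂ 1 ℂ) 0 ![ξ] = 0 := by
    have e3 : T.toBase ∘ e = fun _ => T.toBase q := rfl
    rw [e3]
    refine (DForm.pullback_one_apply (T.k α) _ _ _).trans ?_
    rw [mfderiv_const]
    exact (T.k α (T.toBase q)).map_coord_zero 0 rfl
  refine (DFunLike.congr_fun h1 ![ξ]).trans ?_
  refine (congrArg₂ (· + ·) ?_ h3).trans (add_zero ξ)
  rw [h2]
  exact (pullback_exp_smul A _ ξ).trans (hA.isConnection.vertical _ ξ)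

theorem isConnection_connection [IsManifold 𝓘(ℝ, EM) ∞ M] [IsManifold 𝓘(ℝ, EP) ∞ P]
    (hA : G.IsGerbeConnection A) : IsConnection T.connection where
  smooth := T.smoothAt_connection hA
  invariant := T.connection_invariant hA
  vertical := T.connection_vertical hA

/-- As `tgt ∘ p α` is the projection to `Y` and `src ∘ p α = s α ∘ π`, the curving equation gives
`d(p α^* A) = f - π^*(s α)^* f`, with `f` pulled back to `Q`. The subtracted term is `π^* d(k α)`,
which the second summand of the connection restores. -/
theorem isCurvature_connection [IsManifold 𝓘(ℝ, EM) ∞ M] [IsManifold 𝓘(ℝ, EP) ∞ P]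
    (hA : G.IsGerbeConnection A) (hf : G.IsCurving A f) :
    IsCurvature T.cocycle.principalBundle T.connection f := by
  funext q
  obtain ⟨α, hα⟩ := T.covers (π q.base)
  have hp := T.contMDiffAt_p hα
  have hp' := hp.mdifferentiableAt (by simp)
  have hb := T.contMDiff_toBase.contMDiffAt (x := q)
  have hb' := hb.mdifferentiableAt (by simp)
  have hs : MDifferentiableAt 𝓘(ℝ, EM) 𝓘(ℝ, EY) (T.s α) (T.toBase q) :=
    ((T.s_smooth α).contMDiffAt ((T.isOpen α).mem_nhds hα)).mdifferentiableAt (by simp)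
  have hn := (T.isOpen_toBase_preimage α).mem_nhds hα
  have hk : (T.k α).SmoothAt (T.toBase q) := T.k_smooth _ _ hα
  have h1 : (A.pullback (T.p α) : DForm (EY × ℂ) 1 T.cocycle.Total).SmoothAt q :=
    DForm.SmoothAt.pullback (hA.isConnection.smooth _) hp
  have h2 : ((T.k α).pullback T.toBase : DForm (EY × ℂ) 1 T.cocycle.Total).SmoothAt q :=
    DForm.SmoothAt.pullback hk hb
  have e1 : G.tgt ∘ T.p α =ᶠ[𝓝 q] UnitsCocycle.Total.base := by
    filter_upwards [hn] with q' hq' using T.tgt_p hq'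
  have e2 : G.src ∘ T.p α =ᶠ[𝓝 q] T.s α ∘ T.toBase := by
    filter_upwards [hn] with q' hq' using T.src_p hq'
  have e3 : (f.pullback (T.s α ∘ T.toBase) : DForm (EY × ℂ) 2 T.cocycle.Total) q =
      ((T.k α).d.pullback T.toBase : DForm (EY × ℂ) 2 T.cocycle.Total) q := by
    rw [← DForm.pullback_comp_apply f hs hb']
    exact DForm.pullback_congr_form (T.pullback_s hα)
  rw [DForm.d_congr (T.eventually_connection_eq hA hα), DForm.d_add h1 h2,
    DForm.d_pullback (hA.isConnection.smooth _) hp, DForm.d_pullback hk hb,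
    hf.descent, DForm.pullback_sub, Pi.sub_apply,
    DForm.pullback_comp_apply f (G.contMDiff_tgt.mdifferentiableAt (by simp)) hp',
    DForm.pullback_comp_apply f (G.contMDiff_src.mdifferentiableAt (by simp)) hp',
    DForm.pullback_congr_apply f e1, DForm.pullback_congr_apply f e2, e3, sub_add_cancel]
  rfl

end BundleGerbe.Splitting

end Trivialisation


/-! ### The isomorphism `δ(Q) ≅ P` and its compatibility with the connections -/

section Isomorphism

open Filter Set

variable {EM : Type*} [NormedAddCommGroup EM] [NormedSpace ℝ EM]
  {M : Type*} [TopologicalSpace M] [ChartedSpace EM M]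
  {EY : Type*} [NormedAddCommGroup EY] [NormedSpace ℝ EY]
  {Y : Type uY} [TopologicalSpace Y] [ChartedSpace EY Y] [IsManifold 𝓘(ℝ, EY) ∞ Y]
  {EP : Type*} [NormedAddCommGroup EP] [NormedSpace ℝ EP]
  {P : Type*} [TopologicalSpace P] [ChartedSpace EP P] [MulAction ℂˣ P]
  {π : Y → M} {G : BundleGerbe EM EY EP P π} {A : DForm EP 1 P} {f : DForm EY 2 Y} {ι : Type*}
  (T : G.Splitting A f ι)

namespace BundleGerbe.Splitting

/-- The pairs of points of the glued bundle over the same point of `M`. -/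
abbrev pairs : Set (T.cocycle.Total × T.cocycle.Total) := deltaPairs T.cocycle.principalBundle π

/-- The quotient `p(q₁)⁻¹ p(q₂)`. -/
noncomputable def div (q₁ q₂ : T.cocycle.Total) : P :=
  G.ldiv (T.p (T.idx q₁.base) q₁) (T.p (T.idx q₁.base) q₂)

variable {T}

theorem π_base_eq {q₁ q₂ : T.cocycle.Total} (h : (q₁, q₂) ∈ T.pairs) :
    π q₁.base = π q₂.base := h

theorem mem_of_pair {q₁ q₂ : T.cocycle.Total} (h : (q₁, q₂) ∈ T.pairs) {α : ι}
    (hα : π q₁.base ∈ T.U α) : π q₂.base ∈ T.U α := π_base_eq h ▸ hα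

theorem src_p_eq {q₁ q₂ : T.cocycle.Total} (h : (q₁, q₂) ∈ T.pairs) {α : ι}
    (hα : π q₁.base ∈ T.U α) : G.src (T.p α q₁) = G.src (T.p α q₂) := by
  rw [T.src_p hα, T.src_p (mem_of_pair h hα), π_base_eq h]

/-- Both points lie over the same point of `M`, so a change of index multiplies `p q₁` and `p q₂` on
the left by the same `ρ`, which cancels in the quotient. -/
theorem div_eq {q₁ q₂ : T.cocycle.Total} (h : (q₁, q₂) ∈ T.pairs) {α : ι}
    (hα : π q₁.base ∈ T.U α) : T.div q₁ q₂ = G.ldiv (T.p α q₁) (T.p α q₂) := by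
  have hi := T.idx_mem q₁.base
  have h2 := mem_of_pair h hα
  have hi2 := mem_of_pair h hi
  obtain ⟨h3, -, h5⟩ := G.ldiv_spec (src_p_eq h hα)
  refine (G.eq_ldiv ?_ ?_).symm
  · rw [T.tgt_p hi, h3, T.tgt_p hα]
  · have hc : G.tgt (T.ρ (T.idx q₁.base) α (π q₁.base)) = G.src (T.p α q₁) := by
      rw [T.tgt_ρ hi hα, T.src_p hα]
    rw [T.p_change hi hα, T.p_change hi2 h2, G.mul_assoc _ _ _ hc h3.symm, h5, π_base_eq h]

theorem div_spec {q₁ q₂ : T.cocycle.Total} (h : (q₁, q₂) ∈ T.pairs) {α : ι}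
    (hα : π q₁.base ∈ T.U α) : G.src (T.div q₁ q₂) = q₁.base ∧ G.tgt (T.div q₁ q₂) = q₂.base ∧
      G.mul (T.p α q₁) (T.div q₁ q₂) = T.p α q₂ := by
  obtain ⟨h3, h4, h5⟩ := G.ldiv_spec (src_p_eq h hα)
  rw [div_eq h hα]
  exact ⟨h3.trans (T.tgt_p hα), h4.trans (T.tgt_p (mem_of_pair h hα)), h5⟩

theorem proj_div {q₁ q₂ : T.cocycle.Total} (h : (q₁, q₂) ∈ T.pairs) :
    G.bundle.proj (T.div q₁ q₂) = (q₁.base, q₂.base) :=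
  Prod.ext (div_spec h (T.idx_mem _)).1 (div_spec h (T.idx_mem _)).2.1

theorem eq_div {q₁ q₂ : T.cocycle.Total} (h : (q₁, q₂) ∈ T.pairs) {α : ι}
    (hα : π q₁.base ∈ T.U α) {r : P} (hr : G.src r = q₁.base)
    (e : G.mul (T.p α q₁) r = T.p α q₂) : r = T.div q₁ q₂ := by
  rw [div_eq h hα]
  exact G.eq_ldiv ((T.tgt_p hα).trans hr.symm) e

theorem div_smul {q₁ q₂ : T.cocycle.Total} (h : (q₁, q₂) ∈ T.pairs) (z : ℂˣ) :
    T.div q₁ (z • q₂) = z • T.div q₁ q₂ := by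
  have hα := T.idx_mem q₁.base
  obtain ⟨h1, -, h3⟩ := div_spec h hα
  refine (eq_div (q₂ := z • q₂) h hα (by rw [G.src_smul, h1]) ?_).symm
  rw [G.mul_smul z ((T.tgt_p hα).trans h1.symm), h3, T.p_smul z (mem_of_pair h hα)]

theorem smul_div_smul {q₁ q₂ : T.cocycle.Total} (h : (q₁, q₂) ∈ T.pairs) (z : ℂˣ) :
    T.div (z • q₁) (z • q₂) = T.div q₁ q₂ := by
  have hα := T.idx_mem q₁.base
  obtain ⟨h1, -, h3⟩ := div_spec h hα
  refine (eq_div (q₁ := z • q₁) (q₂ := z • q₂) h hα h1 ?_).symm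
  rw [T.p_smul z hα, T.p_smul z (mem_of_pair h hα),
    G.smul_mul z ((T.tgt_p hα).trans h1.symm), h3]

theorem div_mul_div {q₁ q₂ q₃ : T.cocycle.Total} (h : (q₁, q₂) ∈ T.pairs)
    (h' : (q₂, q₃) ∈ T.pairs) : G.mul (T.div q₁ q₂) (T.div q₂ q₃) = T.div q₁ q₃ := by
  have hα := T.idx_mem q₁.base
  obtain ⟨h1, h2, h3⟩ := div_spec h hα
  obtain ⟨h4, h5, h6⟩ := div_spec h' (mem_of_pair h hα)
  have hc := h2.trans h4.symm
  refine eq_div ((π_base_eq h).trans (π_base_eq h') : π q₁.base = π q₃.base) hα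
    (by rw [G.src_mul hc, h1]) ?_
  rw [← G.mul_assoc _ _ _ ((T.tgt_p hα).trans h1.symm) hc, h3, h6]

theorem exists_smul_of_base_eq {q q' : T.cocycle.Total} (h : q.base = q'.base) :
    ∃ z : ℂˣ, q = z • q' :=
  (T.cocycle.principalBundle.simply_transitive q q' h).exists

theorem div_injective {q₁ q₂ r₂ : T.cocycle.Total} (h : (q₁, q₂) ∈ T.pairs)
    (h' : (q₁, r₂) ∈ T.pairs) (e : T.div q₁ q₂ = T.div q₁ r₂) : q₂ = r₂ := by
  have hb : q₂.base = r₂.base := by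
    have := (proj_div h).symm.trans ((congrArg _ e).trans (proj_div h'))
    exact congrArg Prod.snd this
  obtain ⟨z, rfl⟩ := exists_smul_of_base_eq hb
  have hz : z = 1 := G.bundle.smul_left_cancel (by rw [← div_smul h', e, one_smul])
  rw [hz, one_smul]

theorem contMDiffOn_div : ContMDiffOn (𝓘(ℝ, EY × ℂ).prod 𝓘(ℝ, EY × ℂ)) 𝓘(ℝ, EP) ∞
    (fun x : T.cocycle.Total × T.cocycle.Total => T.div x.1 x.2) T.pairs := by
  rintro ⟨q₁, q₂⟩ h
  obtain ⟨α, hα⟩ := T.covers (π q₁.base)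
  have hα2 := mem_of_pair h hα
  let s : Set (T.cocycle.Total × T.cocycle.Total) := T.pairs ∩ {x | π x.1.base ∈ T.U α}
  have hs : s ∈ 𝓝[T.pairs] (q₁, q₂) := inter_mem self_mem_nhdsWithin (mem_nhdsWithin_of_mem_nhds
    (((T.isOpen_toBase_preimage α).preimage continuous_fst).mem_nhds hα))
  have h1 : ContMDiffWithinAt (𝓘(ℝ, EY × ℂ).prod 𝓘(ℝ, EY × ℂ)) 𝓘(ℝ, EP) ∞
      (fun x : T.cocycle.Total × T.cocycle.Total => T.p α x.1) s (q₁, q₂) :=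
    (T.contMDiffAt_p hα).comp_contMDiffWithinAt (q₁, q₂) contMDiffWithinAt_fst
  have h2 : ContMDiffWithinAt (𝓘(ℝ, EY × ℂ).prod 𝓘(ℝ, EY × ℂ)) 𝓘(ℝ, EP) ∞
      (fun x : T.cocycle.Total × T.cocycle.Total => T.p α x.2) s (q₁, q₂) :=
    (T.contMDiffAt_p hα2).comp_contMDiffWithinAt (q₁, q₂) contMDiffWithinAt_snd
  have h3 := G.contMDiffWithinAt_ldiv h1 h2 (fun x hx => src_p_eq hx.1 hx.2) ⟨h, hα⟩
  exact (h3.congr (fun x hx => div_eq hx.1 hx.2) (div_eq h hα)).mono_of_mem_nhdsWithin hs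

variable (T) in
/-- The isomorphism `q₁^* ⊗ q₂ ↦ p(q₁)⁻¹ p(q₂)` from `δ(Q)` to the bundle gerbe. -/
noncomputable def deltaIso : DeltaIso T.cocycle.principalBundle G where
  toFun := Quotient.lift (fun x => T.div x.1.1 x.1.2) (by
    rintro ⟨⟨q₁, q₂⟩, h⟩ ⟨⟨r₁, r₂⟩, h'⟩ ⟨z, hz⟩
    obtain ⟨rfl, rfl⟩ := Prod.mk.inj hz
    exact (smul_div_smul h z).symm)
  bijective := by
    constructor
    · rintro ⟨⟨q₁, q₂⟩, h⟩ ⟨⟨r₁, r₂⟩, h'⟩ e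
      have e' : T.div q₁ q₂ = T.div r₁ r₂ := e
      have hb : r₁.base = q₁.base := by
        have := (proj_div h').symm.trans ((congrArg _ e').symm.trans (proj_div h))
        exact congrArg Prod.fst this
      obtain ⟨z, rfl⟩ := exists_smul_of_base_eq hb
      refine Delta.mk_eq_mk.2 ⟨z, rfl, ?_⟩
      have h2 : (z • q₁, z • q₂) ∈ T.pairs := h
      exact (div_injective h2 h' ((smul_div_smul h z).trans e')).symm
    · intro a
      -- Any points over the source and target of `a` would do; the fibre coordinate `1` is
      -- arbitrary, and `q₂` is rescaled afterwards to hit `a`.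
      let q₁ : T.cocycle.Total := ⟨G.src a, 1⟩
      let q₂ : T.cocycle.Total := ⟨G.tgt a, 1⟩
      have h : (q₁, q₂) ∈ T.pairs := G.π_src a
      obtain ⟨z, hz⟩ := G.exists_smul_eq (p := a) (q := T.div q₁ q₂)
        (div_spec h (T.idx_mem _)).1.symm (div_spec h (T.idx_mem _)).2.1.symm
      refine ⟨Delta.mk _ _ q₁ (z • q₂) h, ?_⟩
      exact (div_smul h z).trans hz.symm
  proj_toFun := by
    rintro ⟨⟨q₁, q₂⟩, h⟩
    exact proj_div h
  toFun_smul := by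
    rintro z ⟨⟨q₁, q₂⟩, h⟩
    exact div_smul h z
  toFun_mul := by
    rintro ⟨⟨q₁, q₂⟩, h⟩ ⟨⟨r₂, r₃⟩, h'⟩ hb
    have hb' : q₂.base = r₂.base := hb
    -- The product on `δ(Q)` is computed on representatives with a common middle point, so the
    -- second representative is rescaled to start at `q₂`.
    obtain ⟨z, rfl⟩ := exists_smul_of_base_eq hb'
    have h2 : (z • r₂, z • r₃) ∈ T.pairs := h'
    have h3 : (q₁, z • r₃) ∈ T.pairs :=
      ((π_base_eq h).trans (π_base_eq h2) : π q₁.base = π (z • r₃).base)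
    have e1 : (Quotient.mk _ ⟨(r₂, r₃), h'⟩ : Delta T.cocycle.principalBundle π) =
        Delta.mk _ _ (z • r₂) (z • r₃) h2 := Delta.mk_eq_mk.2 ⟨z, rfl, rfl⟩
    have e2 := Delta.mul_mk (B := T.cocycle.principalBundle) (π := π) h h2 h3
    refine (congrArg _ ((congrArg (Delta.mul _) e1).trans e2)).trans ?_
    refine (div_mul_div h h2).symm.trans ?_
    rw [smul_div_smul h' z]
  lift := T.div
  lift_eq _ _ _ := rfl
  smooth := contMDiffOn_div

/-- The condition on `v₁` and `v₂` is only that they agree in `M`, so the pair is realised in two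
lifts: an arbitrary curve through `q₁` is projected to `M`, lifted to `Y` through `q₂.base`, and
lifted again to `Q` through `q₂`. -/
theorem exists_curve_pairs {q₁ q₂ : T.cocycle.Total} (h : (q₁, q₂) ∈ T.pairs) (v₁ v₂ : EY × ℂ)
    (hv : (mfderiv 𝓘(ℝ, EY × ℂ) 𝓘(ℝ, EM) T.toBase q₁ v₁ : EM) =
      mfderiv 𝓘(ℝ, EY × ℂ) 𝓘(ℝ, EM) T.toBase q₂ v₂) :
    ∃ γ₁ γ₂ : ℝ → T.cocycle.Total, γ₁ 0 = q₁ ∧ γ₂ 0 = q₂ ∧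
      MDifferentiableAt 𝓘(ℝ, ℝ) 𝓘(ℝ, EY × ℂ) γ₁ 0 ∧ MDifferentiableAt 𝓘(ℝ, ℝ) 𝓘(ℝ, EY × ℂ) γ₂ 0 ∧
      (mfderiv 𝓘(ℝ, ℝ) 𝓘(ℝ, EY × ℂ) γ₁ 0 (1 : ℝ) : EY × ℂ) = v₁ ∧
      (mfderiv 𝓘(ℝ, ℝ) 𝓘(ℝ, EY × ℂ) γ₂ 0 (1 : ℝ) : EY × ℂ) = v₂ ∧
      ∀ᶠ t in 𝓝 0, (γ₁ t, γ₂ t) ∈ T.pairs := by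
  obtain ⟨γ₁, rfl, hd₁, rfl⟩ := exists_curve q₁ v₁
  have hb₁ := T.contMDiff_toBase.mdifferentiableAt (x := γ₁ 0) (by simp)
  have hπ := G.contMDiff_π.mdifferentiableAt (x := q₂.base) (by simp)
  have hb := (UnitsCocycle.contMDiff_base (Z := T.cocycle)).mdifferentiableAt (x := q₂) (by simp)
  have e1 := DFunLike.congr_fun (mfderiv_comp 0 hb₁ hd₁) (1 : ℝ)
  have e2 := DFunLike.congr_fun (mfderiv_comp q₂ hπ hb) v₂
  obtain ⟨c, hc0, hdc, hcw, hc⟩ := exists_lift_curve (G.submersion q₂.base)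
    (γ := T.toBase ∘ γ₁) (hb₁.comp 0 hd₁) h
    (mfderiv 𝓘(ℝ, EY × ℂ) 𝓘(ℝ, EY) UnitsCocycle.Total.base q₂ v₂)
    (e2.symm.trans (hv.symm.trans e1.symm))
  obtain ⟨γ₂, h0, hd₂, hw, hγ⟩ := exists_lift_curve (UnitsCocycle.isSubmersionAt_base q₂)
    hdc hc0 v₂ hcw.symm
  refine ⟨γ₁, γ₂, rfl, h0, hd₁, hd₂, rfl, hw, ?_⟩
  filter_upwards [hc, hγ] with t ht ht'
  change π (γ₁ t).base = π (γ₂ t).base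
  have ht'' : (γ₂ t).base = c t := ht'
  rw [ht'']
  exact ht.symm

/-- Along curves realising `(v₁, v₂)` inside the pairs, any derivative `L` within the pairs computes
the velocity of the quotient `r`. The product rule for `p α(γ₁) · r = p α(γ₂)` gives the claim once
the terms in `k α` are cancelled. -/
theorem preservesConnection_deltaIso (hA : G.IsGerbeConnection A) :
    T.deltaIso.PreservesConnection T.connection A := by
  intro q₁ q₂ h L hL v₁ v₂ hv
  obtain ⟨γ₁, γ₂, rfl, rfl, hd₁, hd₂, rfl, rfl, hγ⟩ := exists_curve_pairs h v₁ v₂ hv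
  obtain ⟨α, hα⟩ := T.covers (π (γ₁ 0).base)
  have hα2 := mem_of_pair h hα
  have hp₁ := (T.contMDiffAt_p hα).mdifferentiableAt (by simp)
  have hp₂ := (T.contMDiffAt_p hα2).mdifferentiableAt (by simp)
  let r : ℝ → P := fun t => T.div (γ₁ t) (γ₂ t)
  have hr : HasMFDerivAt 𝓘(ℝ, ℝ) 𝓘(ℝ, EP) r 0 (L.comp
      ((mfderiv 𝓘(ℝ, ℝ) 𝓘(ℝ, EY × ℂ) γ₁ 0).prod (mfderiv 𝓘(ℝ, ℝ) 𝓘(ℝ, EY × ℂ) γ₂ 0))) :=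
    (HasMFDerivWithinAt.comp (g := fun x : T.cocycle.Total × T.cocycle.Total => T.div x.1 x.2)
      (f := fun t => (γ₁ t, γ₂ t)) (0 : ℝ) hL
      (hd₁.hasMFDerivAt.prodMk hd₂.hasMFDerivAt).hasMFDerivWithinAt
      (s := {t | (γ₁ t, γ₂ t) ∈ T.pairs}) fun t ht => ht).hasMFDerivAt hγ
  have hγ' : ∀ᶠ t in 𝓝 0, π (γ₁ t).base ∈ T.U α :=
    hd₁.continuousAt.eventually ((T.isOpen_toBase_preimage α).mem_nhds hα)
  have h1 := hA.pullback_mul (p := T.p α ∘ γ₁) (q := r) (hp₁.comp (0 : ℝ) hd₁)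
    hr.mdifferentiableAt (by
      filter_upwards [hγ, hγ'] with t ht ht'
      exact (T.tgt_p ht').trans (div_spec ht ht').1.symm)
  have h2 : (fun t => G.mul ((T.p α ∘ γ₁) t) (r t)) =ᶠ[𝓝 0] T.p α ∘ γ₂ := by
    filter_upwards [hγ, hγ'] with t ht ht' using (div_spec ht ht').2.2
  rw [DForm.pullback_congr_apply A h2] at h1
  -- Both curves have the same projection to `M` near `0`, so the contributions of `k α` to the two
  -- values of the connection agree.
  have h3 : ((T.k α).pullback (T.toBase ∘ γ₁) : DForm ℝ 1 ℝ) 0 =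
      ((T.k α).pullback (T.toBase ∘ γ₂) : DForm ℝ 1 ℝ) 0 :=
    DForm.pullback_congr_apply _ (hγ.mono fun t ht => ht)
  have h4 : ∀ γ : ℝ → T.cocycle.Total, MDifferentiableAt 𝓘(ℝ, ℝ) 𝓘(ℝ, EY × ℂ) γ 0 →
      π (γ 0).base ∈ T.U α → T.connection (γ 0) ![mfderiv 𝓘(ℝ, ℝ) 𝓘(ℝ, EY × ℂ) γ 0 (1 : ℝ)] =
        (A.pullback (T.p α ∘ γ) : DForm ℝ 1 ℝ) 0 ![(1 : ℝ)] +
          ((T.k α).pullback (T.toBase ∘ γ) : DForm ℝ 1 ℝ) 0 ![(1 : ℝ)] := fun γ hd hα => by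
    refine (DForm.pullback_one_apply T.connection γ 0 (1 : ℝ)).symm.trans ?_
    rw [DForm.pullback_congr_form (T.connection_eq hA hα), DForm.pullback_add, Pi.add_apply,
      DForm.pullback_comp_apply A ((T.contMDiffAt_p hα).mdifferentiableAt (by simp)) hd,
      DForm.pullback_comp_apply (T.k α) (T.contMDiff_toBase.mdifferentiableAt (by simp)) hd]
    rfl
  have h5 : (A.pullback r : DForm ℝ 1 ℝ) 0 ![(1 : ℝ)] = A (r 0) ![L
      (mfderiv 𝓘(ℝ, ℝ) 𝓘(ℝ, EY × ℂ) γ₁ 0 (1 : ℝ), mfderiv 𝓘(ℝ, ℝ) 𝓘(ℝ, EY × ℂ) γ₂ 0 (1 : ℝ))] := by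
    refine (DForm.pullback_one_apply A r 0 (1 : ℝ)).trans ?_
    rw [hr.mfderiv]
    rfl
  rw [h4 γ₁ hd₁ hα, h4 γ₂ hd₂ hα2, h3, h1]
  refine h5.symm.trans ?_
  change _ = ((A.pullback (T.p α ∘ γ₁) : DForm ℝ 1 ℝ) 0 ![(1 : ℝ)] +
    (A.pullback r : DForm ℝ 1 ℝ) 0 ![(1 : ℝ)] + _) - _
  ring

end BundleGerbe.Splitting

end Isomorphism

end Gerbe

open Gerbe in
theorem mainTheorem4
    {EM : Type*} [NormedAddCommGroup EM] [NormedSpace ℝ EM] [CompleteSpace EM]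
    {M : Type*} [TopologicalSpace M] [ChartedSpace EM M] [IsManifold 𝓘(ℝ, EM) ∞ M]
    {EY : Type*} [NormedAddCommGroup EY] [NormedSpace ℝ EY] [CompleteSpace EY]
    {Y : Type uY} [TopologicalSpace Y] [ChartedSpace EY Y] [IsManifold 𝓘(ℝ, EY) ∞ Y]
    {EP : Type*} [NormedAddCommGroup EP] [NormedSpace ℝ EP] [CompleteSpace EP]
    {P : Type*} [TopologicalSpace P] [ChartedSpace EP P] [IsManifold 𝓘(ℝ, EP) ∞ P]
    [MulAction ℂˣ P]
    {π : Y → M} (G : BundleGerbe EM EY EP P π)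
    (A : DForm EP 1 P) (hA : G.IsGerbeConnection A)
    (f : DForm EY 2 Y) (hf : G.IsCurving A f)
    {ι : Type*} (𝒰 : LerayCover ι M) (c : G.LocalSections 𝒰)
    (hD : (G.deligneCocycle c A f).ClassIsZero 𝒰) :
    ∃ (Q : Type uY) (_ : TopologicalSpace Q) (_ : ChartedSpace (EY × ℂ) Q)
      (_ : IsManifold 𝓘(ℝ, EY × ℂ) ∞ Q) (_ : MulAction ℂˣ Q)
      (B : PrincipalBundle 𝓘(ℝ, EY) (EY × ℂ) Q (Set.univ : Set Y))
      (φ : DeltaIso B G) (AQ : DForm (EY × ℂ) 1 Q),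
      IsConnection AQ ∧ φ.PreservesConnection AQ A ∧ IsCurvature B AQ f := by
  obtain ⟨T⟩ := c.exists_splitting hA.isConnection hD
  exact ⟨T.cocycle.Total, inferInstance, inferInstance, inferInstance, inferInstance,
    T.cocycle.principalBundle, T.deltaIso, T.connection, T.isConnection_connection hA,
    BundleGerbe.Splitting.preservesConnection_deltaIso hA, T.isCurvature_connection hA hf⟩
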